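/- Let $p\in(0,1)$. Let $\epsilon_1=1$, let $\epsilon_2,\epsilon_3,\dots$ be Bernoulli random variables with parameter $p$, and for $n\ge 2$ let $U_n$ be uniformly distributed on $\{1,\dots,n-1\}$, where $\epsilon_2,\epsilon_3,\dots,U_2,U_3,\dots$ are all independent. Put $i(n)=\sum_{j=1}^n\epsilon_j$. Given variables $X_1,X_2,\dots$, set $\hat X_1=X_1$ and, for $n\ge2$, $\hat X_n=\hat X_{U_n}$ if $\epsilon_n=0$ and $\hat X_n=X_{i(n)}$ if $\epsilon_n=1$. Let $N_j(n)$ be the number of occurrences of the variable $X_j$ in $\hat X_1,\dots,\hat X_n$ (variables with different indices being regarded as different, whatever their values), and let $\nu_1(n)=\#\{1\le j\le i(n): N_j(n)=1\}$ be the number of variables that occur exactly once. Let $\sigma_1>0$ be given by $$\sigma_1^2=\frac{2p(1-p)(3-p)}{(3-2p)(2-p)^2}.$$ Then there is a constant $C>0$, depending only on $p$, such that for all $n\ge1$ $$\sup_{x\in\mathbb R}\left|\mathbb P\left(\frac{\nu_1(n)-\frac{np}{2-p}}{\sigma_1\sqrt n}\le x\right)-\Phi(x)\right|\le C n^{-1/2},$$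 where $\Phi$ is the standard normal distribution function. -/

import Mathlib

open MeasureTheory ProbabilityTheory

namespace StepReinforced

/-- `i(n) = ε₁ + ⋯ + εₙ`, for one realization `e` of the sequence `(εₙ)`. -/
def innovations (e : ℕ → ℕ) (n : ℕ) : ℕ := ∑ j ∈ Finset.Icc 1 n, e j

/-- Simon's reinforcement algorithm, for one realization `e`, `u` of `(εₙ)`, `(Uₙ)`:
`X̂₁ = X₁`, and for `n ≥ 2`, `X̂ₙ = X̂_{Uₙ}` if `εₙ = 0` and `X̂ₙ = X_{i(n)}` if `εₙ = 1`.
The value at `n = 0`, and the value when `uₙ ∉ {1, …, n-1}` (an event of probability zero), are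
irrelevant. -/
def reinforced {α : Type*} (X : ℕ → α) (e u : ℕ → ℕ) (n : ℕ) : α :=
  if n ≤ 1 then X 1
  else if _h : e n = 0 ∧ 1 ≤ u n ∧ u n < n then reinforced X e u (u n)
  else X (innovations e n)
termination_by n
decreasing_by exact _h.2.2

/-- The index of the variable that is used at step `l`, that is, the reinforced sequence built from
the formal symbols `X_j := j`. -/
def label (e u : ℕ → ℕ) (l : ℕ) : ℕ := reinforced id e u l

/-- Whatever the variables `X_j` are, `X̂_l` is the variable `X_j` with `j = label l`. -/
theorem reinforced_eq_label {α : Type*} (X : ℕ → α) (e u : ℕ → ℕ) (n : ℕ) :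
    reinforced X e u n = X (label e u n) := by
  unfold label
  induction n using Nat.strong_induction_on with
  | _ n ih =>
    rw [reinforced.eq_1 X e u n, reinforced.eq_1 id e u n]
    split_ifs with h1 h2
    · rfl
    · exact ih _ h2.2.2
    · rfl

/-- `N_j(n)`: the number of occurrences of the variable `X_j` among `X̂₁, …, X̂ₙ`. Occurrences are
those of the variable, not of its value: two variables with different indices are different, even
if they happen to take equal values. -/
def occurrences (e u : ℕ → ℕ) (j n : ℕ) : ℕ :=
  ((Finset.Icc 1 n).filter fun l => label e u l = j).card

/-- `ν_k(n) = #{1 ≤ j ≤ i(n) : N_j(n) = k}`. -/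
def nu (e u : ℕ → ℕ) (k n : ℕ) : ℕ :=
  ((Finset.Icc 1 (innovations e n)).filter fun j => occurrences e u j n = k).card

/-- The random inputs of the algorithm: `ε₁ = 1`; `ε₂, ε₃, …` are Bernoulli with parameter `p`; `Uₙ`
is uniform on `{1, …, n-1}` for `n ≥ 2`; and the variables `ε₂, ε₃, …, U₂, U₃, …` are mutually
independent. -/
structure IsInput {Ω : Type*} [MeasurableSpace Ω] (μ : Measure Ω) (p : ℝ)
    (ε U : ℕ → Ω → ℕ) : Prop where
  eps_one : ∀ ω, ε 1 ω = 1
  measurable_eps : ∀ n, 2 ≤ n → Measurable (ε n)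
  measurable_U : ∀ n, 2 ≤ n → Measurable (U n)
  prob_eps_one : ∀ n, 2 ≤ n → μ.real {ω | ε n ω = 1} = p
  prob_eps_zero : ∀ n, 2 ≤ n → μ.real {ω | ε n ω = 0} = 1 - p
  prob_U : ∀ n, 2 ≤ n → ∀ k, 1 ≤ k → k < n → μ.real {ω | U n ω = k} = 1 / ((n : ℝ) - 1)
  indep : iIndepFun
    (Sum.elim (fun k : ℕ => ε (k + 2)) (fun k : ℕ => U (k + 2)) : ℕ ⊕ ℕ → Ω → ℕ) μ

/-- The Kolmogorov distance `sup_x |P(Y ≤ x) - Φ(x)|` between `Y` and a standard normal variable. -/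
noncomputable def dK {Ω : Type*} [MeasurableSpace Ω] (μ : Measure Ω) (Y : Ω → ℝ) : ℝ :=
  ⨆ x : ℝ, |μ.real {ω | Y ω ≤ x} - cdf (gaussianReal 0 1) x|

/-- `σ₁`, the positive root of `σ₁² = 2p(1-p)(3-p) / ((3-2p)(2-p)²)`. -/
noncomputable def sigmaOne (p : ℝ) : ℝ :=
  √(2 * p * (1 - p) * (3 - p) / ((3 - 2 * p) * (2 - p) ^ 2))

end StepReinforced

/-! The process S_k = ν₁(k) is a Markov chain. An innovation raises it by 1. A copying step picks a
uniform earlier time and lowers it by 1 exactly when the variable used there has occurred once,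
which has conditional probability S_k / k. Let v = p / (2 - p) be the fixed point of the drift
(`nuLim_eq`) and c_k = ∏_{k ≤ j < n} (1 - (1-p)/j). Then c_k (S_k - k v) is a martingale for k ≤ n,
and σ₁² (n - k c_k²) is essentially the variance still to come after time k (`remVar_step`).

The rate comes from Lindeberg replacement along the heat flow, combined with induction on n in the
manner of Bolthausen. Put T_k = σ₁² A + σ₁² (n - k c_k²) and u_k(m) = Φ((x - c_k (m - k v)) / √T_k).
At k = n the mean of u_k(S_k) is the distribution function of S_n smoothed by a Gaussian of variance
σ₁² A; at k = 1 it is Φ up to O(n^{-1/2}) (`abs_testFn_one_sub_le`). With d = c_{k+1} / √T_{k+1},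
one step changes it by at most d³ |E φ''(Z)| (third moment), d² E (|S_k/k - v| + 1/k) b(Z)
(fluctuation of the conditional variance) and d⁴ E b(Z) (Taylor remainder), up to constants, where b
is `bump` (`abs_integral_testFn_step_le`).

Bounded by absolute values, the d³ terms do not sum to something that vanishes with n. For k ≥ n/2
the bound C / √k assumed at time k lets Z be replaced by a Gaussian variable spread much more widely
than b and φ''. This gives E b(Z) = O(C/√k + √(T/k)) and E φ''(Z) = O(C/√k + T/k), the latter
because φ'' integrates to zero (`integral_bump_le`, `abs_integral_npdf₂_le`). For k < n/2, d is of
order n^{-1/2} and trivial bounds suffice. In the sum, C enters only through O(C / √(A n)), since ∑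
(A+j)^{-3/2} = O(A^{-1/2}). Removing the smoothing costs O(√(A/n))
(`abs_cdf_sub_ncdf_le_of_smooth`). A large A, depending on p alone, makes the total factor of C
equal to 1/2, and the induction closes (`exists_berryEsseen_const`). -/

namespace StepReinforced

open Filter Topology

/-! ### The normal density, its derivatives and an integrable majorant -/

/-- The standard normal density. -/
noncomputable def npdf (x : ℝ) : ℝ := gaussianPDFReal 0 1 x

/-- The standard normal distribution function. -/
noncomputable def ncdf (x : ℝ) : ℝ := cdf (gaussianReal 0 1) x

theorem npdf_eq (x : ℝ) : npdf x = (√(2 * Real.pi))⁻¹ * Real.exp (-x ^ 2 / 2) := by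
  simp [npdf, gaussianPDFReal]

theorem npdf_nonneg (x : ℝ) : 0 ≤ npdf x := gaussianPDFReal_nonneg _ _ _

theorem integrable_npdf : Integrable npdf := integrable_gaussianPDFReal 0 1

theorem integral_npdf : ∫ x, npdf x = 1 := integral_gaussianPDFReal_eq_one 0 one_ne_zero

theorem hasDerivAt_npdf (x : ℝ) : HasDerivAt npdf (-x * npdf x) x := by
  have h : HasDerivAt (fun x : ℝ => (√(2 * Real.pi))⁻¹ * Real.exp (-x ^ 2 / 2))
      ((√(2 * Real.pi))⁻¹ * (Real.exp (-x ^ 2 / 2) * (-(2 * x) / 2))) x := by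
    have h1 : HasDerivAt (fun x : ℝ => -x ^ 2 / 2) (-(2 * x) / 2) x := by
      simpa using ((hasDerivAt_pow 2 x).neg.div_const 2)
    exact h1.exp.const_mul _
  have e : npdf = fun x : ℝ => (√(2 * Real.pi))⁻¹ * Real.exp (-x ^ 2 / 2) := funext npdf_eq
  rw [e]
  convert h using 1
  ring

theorem continuous_npdf : Continuous npdf :=
  continuous_iff_continuousAt.2 fun x => (hasDerivAt_npdf x).continuousAt

theorem ncdf_eq_integral (x : ℝ) : ncdf x = ∫ t in Set.Iic x, npdf t := by
  rw [ncdf, cdf_eq_real, Measure.real, gaussianReal_apply_eq_integral 0 one_ne_zero,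
    ENNReal.toReal_ofReal (integral_nonneg fun t => gaussianPDFReal_nonneg _ _ _)]
  rfl

theorem hasDerivAt_ncdf (x : ℝ) : HasDerivAt ncdf (npdf x) x := by
  have e : ncdf = fun y => (∫ t in Set.Iic 0, npdf t) + ∫ t in (0 : ℝ)..y, npdf t := by
    funext y
    rw [ncdf_eq_integral, ← intervalIntegral.integral_Iic_sub_Iic integrable_npdf.integrableOn
      integrable_npdf.integrableOn]
    ring
  rw [e]
  exact (intervalIntegral.integral_hasDerivAt_right (continuous_npdf.intervalIntegrable _ _)
    (continuous_npdf.stronglyMeasurableAtFilter _ _) continuous_npdf.continuousAt).const_add _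

theorem ncdf_nonneg (x : ℝ) : 0 ≤ ncdf x := cdf_nonneg _ x

theorem ncdf_le_one (x : ℝ) : ncdf x ≤ 1 := cdf_le_one _ x

theorem ncdf_mono : Monotone ncdf := monotone_cdf _

theorem continuous_ncdf : Continuous ncdf :=
  continuous_iff_continuousAt.2 fun x => (hasDerivAt_ncdf x).continuousAt

/-- This is t^k / k! ≤ e^t at t = (1 + z²)/2; the surplus factor e^{1/2} is absorbed by √(2π). -/
theorem npdf_le_inv_pow (k : ℕ) (z : ℝ) :
    (1 + z ^ 2) ^ k * npdf z ≤ 2 ^ k * k.factorial := by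
  have h := Real.pow_div_factorial_le_exp (x := (1 + z ^ 2) / 2) (by positivity) k
  have hf : (0 : ℝ) < k.factorial := by positivity
  rw [div_le_iff₀ hf, div_pow, div_le_iff₀ (by positivity)] at h
  have he : Real.exp ((1 + z ^ 2) / 2) * Real.exp (-z ^ 2 / 2) = Real.exp (1 / 2) := by
    rw [← Real.exp_add]; congr 1; ring
  have h1 : Real.exp (1 / 2) ≤ √(2 * Real.pi) := by
    apply Real.le_sqrt_of_sq_le
    rw [← Real.exp_nat_mul]
    have := Real.exp_one_lt_d9
    have := Real.pi_gt_three
    norm_num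
    linarith
  have hs : 0 < √(2 * Real.pi) := Real.sqrt_pos.2 (by positivity)
  rw [npdf_eq]
  calc (1 + z ^ 2) ^ k * ((√(2 * Real.pi))⁻¹ * Real.exp (-z ^ 2 / 2))
      ≤ (Real.exp ((1 + z ^ 2) / 2) * k.factorial * 2 ^ k)
        * ((√(2 * Real.pi))⁻¹ * Real.exp (-z ^ 2 / 2)) := by gcongr
    _ = (Real.exp ((1 + z ^ 2) / 2) * Real.exp (-z ^ 2 / 2)) * (√(2 * Real.pi))⁻¹
        * (2 ^ k * k.factorial) := by ring
    _ ≤ 1 * (2 ^ k * k.factorial) := by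
        rw [he]
        gcongr
        rw [← div_eq_mul_inv, div_le_one hs]
        exact h1
    _ = _ := one_mul _

theorem npdf_le_one (z : ℝ) : npdf z ≤ 1 := by simpa using npdf_le_inv_pow 0 z

/-- The weight `1 / (1 + z²)`, which dominates all the derivatives of the normal density. -/
noncomputable def bump (z : ℝ) : ℝ := (1 + z ^ 2)⁻¹

theorem bump_pos (z : ℝ) : 0 < bump z := by unfold bump; positivity

theorem bump_le_one (z : ℝ) : bump z ≤ 1 := inv_le_one_of_one_le₀ (by nlinarith [sq_nonneg z])

theorem bump_add_le {z h : ℝ} (hh : |h| ≤ 1) : bump (z + h) ≤ 3 * bump z := by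
  unfold bump
  rw [inv_eq_one_div, div_le_iff₀ (by positivity), mul_assoc, inv_mul_eq_div, mul_div_assoc',
    le_div_iff₀ (by positivity)]
  have : h ^ 2 ≤ 1 := by rw [sq_le_one_iff_abs_le_one]; exact hh
  nlinarith [sq_nonneg (z + 2 * h)]

theorem bump_le_of_sq_le {y z : ℝ} (h : z ^ 2 ≤ 2 * y ^ 2) : bump y ≤ 2 * bump z := by
  unfold bump
  rw [inv_eq_one_div, div_le_iff₀ (by positivity), mul_assoc, inv_mul_eq_div, mul_div_assoc',
    le_div_iff₀ (by positivity)]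
  linarith

/-- A polynomial bound turns into domination by `bump`. -/
theorem abs_mul_npdf_le {P z K : ℝ} (k : ℕ) (hP : |P| ≤ K * (1 + z ^ 2) ^ k) (hK : 0 ≤ K) :
    |P * npdf z| ≤ K * (2 ^ (k + 1) * (k + 1).factorial) * bump z := by
  have h := npdf_le_inv_pow (k + 1) z
  rw [abs_mul, abs_of_nonneg (npdf_nonneg z)]
  have h0 : 0 < 1 + z ^ 2 := by positivity
  have : (1 + z ^ 2) ^ k * npdf z ≤ (2 ^ (k + 1) * (k + 1).factorial) * bump z := by
    unfold bump
    rw [← div_eq_mul_inv, le_div_iff₀ h0]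
    calc _ = (1 + z ^ 2) ^ (k + 1) * npdf z := by ring
      _ ≤ _ := h
  calc |P| * npdf z ≤ K * (1 + z ^ 2) ^ k * npdf z := by
        gcongr; exact npdf_nonneg z
    _ = K * ((1 + z ^ 2) ^ k * npdf z) := by ring
    _ ≤ K * ((2 ^ (k + 1) * (k + 1).factorial) * bump z) := by gcongr
    _ = _ := by ring

/-- `φ'`. -/
noncomputable def npdf₁ (z : ℝ) : ℝ := -z * npdf z

/-- `φ''`. -/
noncomputable def npdf₂ (z : ℝ) : ℝ := (z ^ 2 - 1) * npdf z

/-- `φ'''`. -/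
noncomputable def npdf₃ (z : ℝ) : ℝ := (3 * z - z ^ 3) * npdf z

theorem hasDerivAt_npdf₁ (z : ℝ) : HasDerivAt npdf₁ (npdf₂ z) z := by
  have := (hasDerivAt_id z).neg.mul (hasDerivAt_npdf z)
  refine HasDerivAt.congr_deriv this ?_
  simp [npdf₂]; ring

theorem hasDerivAt_npdf₂ (z : ℝ) : HasDerivAt npdf₂ (npdf₃ z) z := by
  have := ((hasDerivAt_pow 2 z).sub_const 1).mul (hasDerivAt_npdf z)
  refine HasDerivAt.congr_deriv this ?_
  simp [npdf₃]; ring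

theorem abs_npdf₁_le (z : ℝ) : |npdf₁ z| ≤ 8 * bump z := by
  have := abs_mul_npdf_le (P := -z) (z := z) (K := 1) 1
    (by rw [abs_neg, abs_le]; constructor <;> nlinarith [sq_nonneg (z - 1), sq_nonneg (z + 1)])
    (by simp)
  norm_num [Nat.factorial] at this
  simpa [npdf₁] using this

theorem abs_npdf₂_le (z : ℝ) : |npdf₂ z| ≤ 8 * bump z := by
  have := abs_mul_npdf_le (P := z ^ 2 - 1) (z := z) (K := 1) 1
    (by rw [abs_le]; constructor <;> nlinarith [sq_nonneg z])
    (by simp)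
  norm_num [Nat.factorial, -abs_mul] at this
  exact this

theorem abs_npdf₃_le (z : ℝ) : |npdf₃ z| ≤ 144 * bump z := by
  have := abs_mul_npdf_le (P := 3 * z - z ^ 3) (z := z) (K := 3) 2
    (by
      rw [abs_le]
      constructor <;> nlinarith [sq_nonneg (z ^ 2 - z), sq_nonneg (z ^ 2 + z), sq_nonneg (z - 1),
        sq_nonneg (z + 1), sq_nonneg z])
    (by simp)
  norm_num [Nat.factorial, -abs_mul] at this
  exact this

/-! ### Expansions of Φ under a shift and under a change of variance -/

theorem abs_le_of_mem_segment_zero {r s : ℝ} (h : r ∈ segment ℝ 0 s) : |r| ≤ |s| := by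
  obtain ⟨a, b, ha, hb, hab, rfl⟩ := h
  simp only [smul_eq_mul, mul_zero, zero_add, abs_mul, abs_of_nonneg hb]
  exact mul_le_of_le_one_left (abs_nonneg _) (by linarith)

/-- One step of a Taylor estimate. -/
theorem abs_le_of_abs_deriv_le {f f' : ℝ → ℝ} {B : ℝ} {S : Set ℝ} (hS : Convex ℝ S)
    (h0S : (0 : ℝ) ∈ S) (n : ℕ)
    (hf0 : f 0 = 0) (hB : 0 ≤ B) (hf : ∀ s ∈ S, HasDerivAt f (f' s) s)
    (hf' : ∀ s ∈ S, |f' s| ≤ B * |s| ^ n) {s : ℝ} (hs : s ∈ S) : |f s| ≤ B * |s| ^ (n + 1) := by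
  have hseg : segment ℝ 0 s ⊆ S := hS.segment_subset h0S hs
  have := Convex.norm_image_sub_le_of_norm_hasDerivWithin_le (f := f) (f' := f')
    (C := B * |s| ^ n) (s := segment ℝ 0 s) (x := 0) (y := s)
    (fun r hr => (hf r (hseg hr)).hasDerivWithinAt)
    (fun r hr => (hf' r (hseg hr)).trans (by
      have := abs_le_of_mem_segment_zero hr
      gcongr))
    (convex_segment _ _) (left_mem_segment _ _ _) (right_mem_segment _ _ _)
  rw [hf0, sub_zero, sub_zero, Real.norm_eq_abs, Real.norm_eq_abs] at this
  rw [pow_succ, ← mul_assoc]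
  exact this

/-- The remainder keeps the weight at z itself, so that it can later be averaged over z. The
constant is 144 for φ''' times 3 for moving `bump` by at most 1; the bound is integrated up from
φ''' one order at a time. -/
theorem abs_ncdf_taylor_le {z h : ℝ} (hh : |h| ≤ 1) :
    |ncdf (z + h) - ncdf z - h * npdf z - h ^ 2 / 2 * npdf₁ z - h ^ 3 / 6 * npdf₂ z|
      ≤ 432 * bump z * h ^ 4 := by
  have hS : Convex ℝ (Set.Icc (-1 : ℝ) 1) := convex_Icc _ _
  have h0 : (0 : ℝ) ∈ Set.Icc (-1 : ℝ) 1 := by simp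
  have hm : h ∈ Set.Icc (-1 : ℝ) 1 := abs_le.1 hh
  have hB : 0 ≤ 432 * bump z := by have := bump_pos z; positivity
  have hadd : ∀ s : ℝ, HasDerivAt (fun s => z + s) 1 s := fun s => (hasDerivAt_id s).const_add z
  have r3 : ∀ s ∈ Set.Icc (-1 : ℝ) 1, |npdf₂ (z + s) - npdf₂ z| ≤ 432 * bump z * |s| ^ 1 := by
    intro s hs
    refine abs_le_of_abs_deriv_le (f := fun s => npdf₂ (z + s) - npdf₂ z)
      (f' := fun s => npdf₃ (z + s)) hS h0 0 (by simp) hB ?_ ?_ hs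
    · intro s _
      simpa using ((hasDerivAt_npdf₂ (z + s)).comp s (hadd s)).sub_const (npdf₂ z)
    · intro s hs
      have := abs_npdf₃_le (z + s)
      have := bump_add_le (z := z) (abs_le.2 hs)
      simp only [pow_zero, mul_one]
      linarith
  have r2 : ∀ s ∈ Set.Icc (-1 : ℝ) 1,
      |npdf₁ (z + s) - npdf₁ z - s * npdf₂ z| ≤ 432 * bump z * |s| ^ 2 := by
    intro s hs
    refine abs_le_of_abs_deriv_le (f := fun s => npdf₁ (z + s) - npdf₁ z - s * npdf₂ z)
      (f' := fun s => npdf₂ (z + s) - npdf₂ z) hS h0 1 (by simp) hB ?_ r3 hs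
    intro s _
    have := (((hasDerivAt_npdf₁ (z + s)).comp s (hadd s)).sub_const (npdf₁ z)).sub
      ((hasDerivAt_id s).mul_const (npdf₂ z))
    refine HasDerivAt.congr_deriv this ?_
    simp
  have r1 : ∀ s ∈ Set.Icc (-1 : ℝ) 1,
      |npdf (z + s) - npdf z - s * npdf₁ z - s ^ 2 / 2 * npdf₂ z| ≤ 432 * bump z * |s| ^ 3 := by
    intro s hs
    refine abs_le_of_abs_deriv_le
      (f := fun s => npdf (z + s) - npdf z - s * npdf₁ z - s ^ 2 / 2 * npdf₂ z)
      (f' := fun s => npdf₁ (z + s) - npdf₁ z - s * npdf₂ z) hS h0 2 (by simp) hB ?_ r2 hs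
    intro s _
    have := ((((hasDerivAt_npdf (z + s)).comp s (hadd s)).sub_const (npdf z)).sub
      ((hasDerivAt_id s).mul_const (npdf₁ z))).sub
      (((hasDerivAt_pow 2 s).div_const 2).mul_const (npdf₂ z))
    refine HasDerivAt.congr_deriv this ?_
    simp [npdf₁]
  have r0 := abs_le_of_abs_deriv_le
      (f := fun s => ncdf (z + s) - ncdf z - s * npdf z - s ^ 2 / 2 * npdf₁ z
        - s ^ 3 / 6 * npdf₂ z)
      (f' := fun s => npdf (z + s) - npdf z - s * npdf₁ z - s ^ 2 / 2 * npdf₂ z) hS h0 3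
      (by simp) hB ?_ r1 hm
  · have e : |h| ^ 4 = h ^ 4 := by rw [← abs_pow, abs_of_nonneg (by positivity)]
    rw [← e]; exact r0
  · intro s _
    have := (((((hasDerivAt_ncdf (z + s)).comp s (hadd s)).sub_const (ncdf z)).sub
      ((hasDerivAt_id s).mul_const (npdf z))).sub
      (((hasDerivAt_pow 2 s).div_const 2).mul_const (npdf₁ z))).sub
      (((hasDerivAt_pow 3 s).div_const 6).mul_const (npdf₂ z))
    refine HasDerivAt.congr_deriv this ?_
    simp
    left
    ring

theorem hasDerivAt_div_sqrt_one_add (z : ℝ) {r : ℝ} (hr : 0 < 1 + r) :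
    HasDerivAt (fun r => z / √(1 + r)) (-(z / √(1 + r)) / (2 * (1 + r))) r := by
  have h1 : HasDerivAt (fun r : ℝ => 1 + r) 1 r := (hasDerivAt_id r).const_add 1
  have h2 := (h1.sqrt hr.ne').inv (Real.sqrt_pos.2 hr).ne'
  have h3 := h2.const_mul z
  have hs : 0 < √(1 + r) := Real.sqrt_pos.2 hr
  refine HasDerivAt.congr_deriv h3 ?_
  have e : (1 + r) = √(1 + r) ^ 2 := (Real.sq_sqrt hr.le).symm
  field_simp
  rw [← e]

/-- The heat equation: adding variance r acts to first order as r/2 times the second space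
derivative of Φ. This is the term that cancels the second moment of a step of the chain. -/
theorem abs_ncdf_div_sqrt_le {z r : ℝ} (hr0 : 0 ≤ r) (hr1 : r ≤ 1) :
    |ncdf (z / √(1 + r)) - ncdf z - r / 2 * npdf₁ z| ≤ 200 * bump z * r ^ 2 := by
  have hS : Convex ℝ (Set.Icc (0 : ℝ) 1) := convex_Icc _ _
  have h0 : (0 : ℝ) ∈ Set.Icc (0 : ℝ) 1 := by simp
  have hB : 0 ≤ 200 * bump z := by have := bump_pos z; positivity
  have r1 : ∀ s ∈ Set.Icc (0 : ℝ) 1,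
      |npdf₁ (z / √(1 + s)) / (2 * (1 + s)) - npdf₁ z / 2| ≤ 200 * bump z * |s| ^ 1 := by
    intro s hs
    refine abs_le_of_abs_deriv_le
      (f := fun s => npdf₁ (z / √(1 + s)) / (2 * (1 + s)) - npdf₁ z / 2)
      (f' := fun s => (npdf₂ (z / √(1 + s)) * (-(z / √(1 + s)) / (2 * (1 + s))) * (2 * (1 + s))
        - npdf₁ (z / √(1 + s)) * 2) / (2 * (1 + s)) ^ 2) hS h0 0 (by simp) hB ?_ ?_ hs
    · intro s hs
      have hp : 0 < 1 + s := by linarith [hs.1]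
      have h1 : HasDerivAt (fun s : ℝ => 2 * (1 + s)) 2 s := by
        simpa using ((hasDerivAt_id s).const_add 1).const_mul 2
      exact ((((hasDerivAt_npdf₁ _).comp s (hasDerivAt_div_sqrt_one_add z hp)).div h1
        (by positivity)).sub_const _)
    · intro s hs
      have hp : 1 ≤ 1 + s := by linarith [hs.1]
      have hp0 : 0 < 1 + s := by linarith
      set y := z / √(1 + s) with hy
      have hyz : z ^ 2 ≤ 2 * y ^ 2 := by
        rw [hy, div_pow, Real.sq_sqrt hp0.le, mul_div_assoc', le_div_iff₀ hp0]
        nlinarith [hs.2, sq_nonneg z]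
      have hb := bump_le_of_sq_le hyz
      -- The second derivative in the variance is again a pure space derivative, φ''' up to the
      -- factor (2(1+s))⁻².
      have e : (npdf₂ y * (-y / (2 * (1 + s))) * (2 * (1 + s)) - npdf₁ y * 2) / (2 * (1 + s)) ^ 2
          = ((3 * y - y ^ 3) * npdf y) / (2 * (1 + s)) ^ 2 := by
        unfold npdf₁ npdf₂
        field_simp
        ring
      rw [e, abs_div, pow_zero, mul_one, div_le_iff₀ (by positivity)]
      have h3 := abs_npdf₃_le y
      unfold npdf₃ at h3
      have h4 : (4 : ℝ) ≤ |(2 * (1 + s)) ^ 2| := by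
        rw [abs_of_nonneg (by positivity)]; nlinarith
      have := bump_pos z
      nlinarith
  have r0 := abs_le_of_abs_deriv_le
      (f := fun s => ncdf (z / √(1 + s)) - ncdf z - s / 2 * npdf₁ z)
      (f' := fun s => npdf₁ (z / √(1 + s)) / (2 * (1 + s)) - npdf₁ z / 2) hS h0 1
      (by simp) hB ?_ r1 (s := r) ⟨hr0, hr1⟩
  · rwa [abs_of_nonneg hr0] at r0
  · intro s hs
    have hp : 0 < 1 + s := by linarith [hs.1]
    have := (((hasDerivAt_ncdf _).comp s (hasDerivAt_div_sqrt_one_add z hp)).sub_const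
      (ncdf z)).sub (((hasDerivAt_id s).div_const 2).mul_const (npdf₁ z))
    refine HasDerivAt.congr_deriv this ?_
    simp [npdf₁]
    ring

theorem abs_ncdf_sub_le (x y : ℝ) : |ncdf x - ncdf y| ≤ |x - y| := by
  have := Convex.norm_image_sub_le_of_norm_hasDerivWithin_le (f := ncdf) (f' := npdf)
    (C := 1) (s := Set.univ) (x := y) (y := x)
    (fun r _ => (hasDerivAt_ncdf r).hasDerivWithinAt)
    (fun r _ => by rw [Real.norm_eq_abs, abs_of_nonneg (npdf_nonneg r)]; exact npdf_le_one r)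
    convex_univ trivial trivial
  simpa using this

/-! ### Transferring a Kolmogorov bound to smooth test functions -/

section Comparison

variable {g g' : ℝ → ℝ}

/-- Integration by parts against a distribution function. -/
theorem integral_eq_neg_integral_deriv_mul_cdf (P : Measure ℝ) [IsProbabilityMeasure P]
    (hg : ∀ x, HasDerivAt g (g' x) x) (hg' : Integrable g') (htop : Tendsto g atTop (𝓝 0)) :
    ∫ y, g y ∂P = -∫ t, g' t * cdf P t := by
  have h1 : ∀ y, g y = -∫ t, (Set.Ici y).indicator g' t := by
    intro y
    rw [integral_indicator measurableSet_Ici, integral_Ici_eq_integral_Ioi,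
      integral_Ioi_of_hasDerivAt_of_tendsto' (fun x _ => hg x) hg'.integrableOn htop]
    ring
  have hint : Integrable (Function.uncurry fun y t => (Set.Ici y).indicator g' t)
      (P.prod volume) := by
    have hS : MeasurableSet {z : ℝ × ℝ | z.1 ≤ z.2} :=
      measurableSet_le measurable_fst measurable_snd
    have := (hg'.comp_snd P).indicator hS
    refine this.congr (Eventually.of_forall fun z => ?_)
    simp [Function.uncurry, Set.indicator]
  calc ∫ y, g y ∂P = ∫ y, (-∫ t, (Set.Ici y).indicator g' t) ∂P := by simp_rw [← h1]
    _ = -∫ y, (∫ t, (Set.Ici y).indicator g' t) ∂P := integral_neg _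
    _ = -∫ t, (∫ y, (Set.Ici y).indicator g' t ∂P) := by rw [integral_integral_swap hint]
    _ = -∫ t, g' t * cdf P t := by
        congr 1
        refine integral_congr_ae (Eventually.of_forall fun t => ?_)
        have : (fun y => (Set.Ici y).indicator g' t) = (Set.Iic t).indicator fun _ => g' t := by
          funext y; simp [Set.indicator]
        simp only [this]
        rw [integral_indicator measurableSet_Iic, setIntegral_const, cdf_eq_real, smul_eq_mul,
          mul_comm]

theorem integrable_mul_cdf (P : Measure ℝ) (hg' : Integrable g') :
    Integrable fun t => g' t * cdf P t := by
  refine hg'.mul_bdd (c := 1) (monotone_cdf P).measurable.aestronglyMeasurable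
    (Eventually.of_forall fun t => ?_)
  rw [Real.norm_eq_abs, abs_of_nonneg (cdf_nonneg P t)]
  exact cdf_le_one P t

/-- After integration by parts both measures enter only through their distribution functions, so the
Kolmogorov distance is multiplied by the total variation of g. That variation is unchanged by affine
rescaling, which is why no power of b / s appears when this is applied. -/
theorem abs_integral_sub_integral_le (P Q : Measure ℝ) [IsProbabilityMeasure P]
    [IsProbabilityMeasure Q] (hg : ∀ x, HasDerivAt g (g' x) x) (hg' : Integrable g')
    (htop : Tendsto g atTop (𝓝 0)) {δ : ℝ} (hδ : ∀ t, |cdf P t - cdf Q t| ≤ δ) :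
    |∫ y, g y ∂P - ∫ y, g y ∂Q| ≤ δ * ∫ t, |g' t| := by
  rw [integral_eq_neg_integral_deriv_mul_cdf P hg hg' htop,
    integral_eq_neg_integral_deriv_mul_cdf Q hg hg' htop, neg_sub_neg,
    ← integral_sub (integrable_mul_cdf Q hg') (integrable_mul_cdf P hg'), ← integral_const_mul]
  refine (abs_integral_le_integral_abs).trans (integral_mono_of_nonneg
    (Eventually.of_forall fun t => abs_nonneg _) (hg'.abs.const_mul δ)
    (Eventually.of_forall fun t => ?_))
  simp only
  rw [← mul_sub, abs_mul, mul_comm, abs_sub_comm]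
  exact mul_le_mul_of_nonneg_right (hδ t) (abs_nonneg _)

end Comparison

theorem integral_comp_sub_mul_div (f : ℝ → ℝ) (x : ℝ) {b s : ℝ} (hb : 0 < b) (hs : 0 < s) :
    ∫ y, f ((x - b * y) / s) = s / b * ∫ y, f y := by
  have e : ∀ y, (x - b * y) / s = (x / b - y) / (s / b) := fun y => by field_simp
  simp_rw [e]
  rw [integral_sub_left_eq_self (fun y => f (y / (s / b))) volume (x / b),
    Measure.integral_comp_div, abs_of_pos (div_pos hs hb), smul_eq_mul]

theorem integrable_comp_sub_mul_div {f : ℝ → ℝ} (hf : Integrable f) (x : ℝ) {b s : ℝ}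
    (hb : 0 < b) (hs : 0 < s) : Integrable fun y => f ((x - b * y) / s) := by
  have e : ∀ y, (x - b * y) / s = (x / b - y) / (s / b) := fun y => by field_simp
  simp_rw [e]
  exact (hf.comp_div (div_pos hs hb).ne').comp_sub_left (x / b)

theorem tendsto_sub_mul_div_atBot (x : ℝ) {b s : ℝ} (hb : 0 < b) (hs : 0 < s) :
    Tendsto (fun y => (x - b * y) / s) atTop atBot := by
  refine Tendsto.atBot_div_const hs ?_
  exact tendsto_atBot_add_const_left _ x (tendsto_neg_atTop_atBot.comp
    (tendsto_id.const_mul_atTop hb)) |>.congr fun y => by simp [sub_eq_add_neg]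

theorem hasDerivAt_sub_mul_div (x b s y : ℝ) :
    HasDerivAt (fun y => (x - b * y) / s) (-b / s) y := by
  simpa using ((((hasDerivAt_id y).const_mul b).const_sub x).div_const s)

theorem integral_gaussian_eq (g : ℝ → ℝ) :
    ∫ y, g y ∂(gaussianReal 0 1) = ∫ y, npdf y * g y := by
  rw [integral_gaussianReal_eq_integral_smul one_ne_zero]
  rfl

/-- Comparison of expectations with their normal counterparts, for test functions on an affine
scale. -/
theorem abs_integral_sub_gaussian_le (P : Measure ℝ) [IsProbabilityMeasure P] {F F' : ℝ → ℝ}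
    (hF : ∀ x, HasDerivAt F (F' x) x) (hF' : Integrable F') (hbot : Tendsto F atBot (𝓝 0))
    {δ : ℝ} (hδ : ∀ t, |cdf P t - ncdf t| ≤ δ) (x : ℝ) {b s : ℝ} (hb : 0 < b) (hs : 0 < s) :
    |∫ y, F ((x - b * y) / s) ∂P - ∫ y, npdf y * F ((x - b * y) / s)| ≤ δ * ∫ t, |F' t| := by
  have h := abs_integral_sub_integral_le (g := fun y => F ((x - b * y) / s))
    (g' := fun y => F' ((x - b * y) / s) * (-b / s)) P (gaussianReal 0 1)
    (fun y => (hF _).comp y (hasDerivAt_sub_mul_div x b s y))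
    ((integrable_comp_sub_mul_div hF' x hb hs).mul_const _)
    (hbot.comp (tendsto_sub_mul_div_atBot x hb hs)) hδ
  rw [integral_gaussian_eq] at h
  refine h.trans_eq ?_
  congr 1
  simp_rw [abs_mul]
  rw [integral_mul_const, integral_comp_sub_mul_div (fun y => |F' y|) x hb hs, neg_div, abs_neg,
    abs_of_pos (div_pos hb hs)]
  field_simp

theorem integrable_bump : Integrable bump := integrable_inv_one_add_sq

theorem integral_bump : ∫ x, bump x = Real.pi := integral_univ_inv_one_add_sq

theorem integrable_of_abs_le_bump {f : ℝ → ℝ} {K : ℝ} (hf : Continuous f)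
    (h : ∀ z, |f z| ≤ K * bump z) : Integrable f :=
  (integrable_bump.const_mul K).mono' hf.aestronglyMeasurable (Eventually.of_forall h)

theorem integral_abs_le_of_abs_le_bump {f : ℝ → ℝ} {K : ℝ} (h : ∀ z, |f z| ≤ K * bump z) :
    ∫ z, |f z| ≤ K * Real.pi := by
  rw [← integral_bump, ← integral_const_mul]
  exact integral_mono_of_nonneg (Eventually.of_forall fun t => abs_nonneg _)
    (integrable_bump.const_mul K) (Eventually.of_forall h)

theorem tendsto_bump_atBot : Tendsto bump atBot (𝓝 0) := by
  unfold bump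
  refine tendsto_inv_atTop_zero.comp (tendsto_atTop_add_const_left _ _ ?_)
  have := (tendsto_pow_atTop (α := ℝ) (n := 2) two_ne_zero).comp tendsto_neg_atBot_atTop
  exact this.congr fun x => by simp

theorem tendsto_zero_of_abs_le_bump {f : ℝ → ℝ} {K : ℝ} (h : ∀ z, |f z| ≤ K * bump z) :
    Tendsto f atBot (𝓝 0) :=
  squeeze_zero_norm h (by simpa using tendsto_bump_atBot.const_mul K)

theorem continuous_npdf₁ : Continuous npdf₁ :=
  continuous_iff_continuousAt.2 fun x => (hasDerivAt_npdf₁ x).continuousAt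

theorem continuous_npdf₂ : Continuous npdf₂ :=
  continuous_iff_continuousAt.2 fun x => (hasDerivAt_npdf₂ x).continuousAt

theorem continuous_npdf₃ : Continuous npdf₃ := by
  unfold npdf₃
  have := continuous_npdf
  fun_prop

theorem continuous_bump : Continuous bump := by
  unfold bump
  exact Continuous.inv₀ (by fun_prop) fun x => by positivity

/-- Under the Gaussian law the density is at most 1, so the mean of a bump of width s / b is at most
π s / b; the passage from the Gaussian law to P costs π δ. -/
theorem integral_bump_le (P : Measure ℝ) [IsProbabilityMeasure P]
    {δ : ℝ} (hδ : ∀ t, |cdf P t - ncdf t| ≤ δ) (x : ℝ) {b s : ℝ} (hb : 0 < b) (hs : 0 < s) :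
    ∫ y, bump ((x - b * y) / s) ∂P ≤ 4 * (δ + s / b) := by
  have hd : ∀ z, HasDerivAt bump (-(2 * z) / (1 + z ^ 2) ^ 2) z := by
    intro z
    have := (((hasDerivAt_pow 2 z).const_add 1).inv (by positivity : 1 + z ^ 2 ≠ 0))
    refine HasDerivAt.congr_deriv this ?_
    simp
  have hb' : ∀ z, |-(2 * z) / (1 + z ^ 2) ^ 2| ≤ 1 * bump z := by
    intro z
    unfold bump
    rw [abs_div, abs_of_nonneg (by positivity : 0 ≤ (1 + z ^ 2) ^ 2), div_le_iff₀ (by positivity),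
      one_mul, pow_two (1 + z ^ 2), ← mul_assoc, inv_mul_cancel₀ (by positivity), one_mul, abs_le]
    constructor <;> nlinarith [sq_nonneg (z - 1), sq_nonneg (z + 1)]
  have hc : Continuous fun z : ℝ => -(2 * z) / (1 + z ^ 2) ^ 2 :=
    Continuous.div (by fun_prop) (by fun_prop) fun z => by positivity
  have h := abs_integral_sub_gaussian_le P hd (integrable_of_abs_le_bump hc hb')
    tendsto_bump_atBot hδ x hb hs
  have h2 := integral_abs_le_of_abs_le_bump hb'
  have h3 : ∫ y, npdf y * bump ((x - b * y) / s) ≤ s / b * Real.pi := by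
    rw [← integral_bump, ← integral_comp_sub_mul_div bump x hb hs]
    refine integral_mono_of_nonneg
      (Eventually.of_forall fun t => mul_nonneg (npdf_nonneg _) (bump_pos _).le)
      (integrable_comp_sub_mul_div integrable_bump x hb hs) (Eventually.of_forall fun t => ?_)
    exact mul_le_of_le_one_left (bump_pos _).le (npdf_le_one t)
  have hδ0 : 0 ≤ δ := (abs_nonneg _).trans (hδ 0)
  have := Real.pi_lt_four
  have hsb := div_pos hs hb
  have h4 := (abs_le.1 h).2
  nlinarith

/-- Compared with `integral_bump_le` there is a second factor s / b. In the Gaussian integral one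
derivative is moved from φ'' onto the density, which gains s / b, and the remaining φ' is
concentrated on a set of width s / b. -/
theorem abs_integral_npdf₂_le (P : Measure ℝ) [IsProbabilityMeasure P]
    {δ : ℝ} (hδ : ∀ t, |cdf P t - ncdf t| ≤ δ) (x : ℝ) {b s : ℝ} (hb : 0 < b) (hs : 0 < s) :
    |∫ y, npdf₂ ((x - b * y) / s) ∂P| ≤ 600 * (δ + (s / b) ^ 2) := by
  have h := abs_integral_sub_gaussian_le P hasDerivAt_npdf₂
    (integrable_of_abs_le_bump continuous_npdf₃ abs_npdf₃_le)
    (tendsto_zero_of_abs_le_bump abs_npdf₂_le) hδ x hb hs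
  have h2 := integral_abs_le_of_abs_le_bump abs_npdf₃_le
  have hsb := div_pos hs hb
  have hi1 := integrable_of_abs_le_bump continuous_npdf₁ abs_npdf₁_le
  have hi2 := integrable_of_abs_le_bump continuous_npdf₂ abs_npdf₂_le
  have hi1' := integrable_comp_sub_mul_div hi1 x hb hs
  have hi2' := integrable_comp_sub_mul_div hi2 x hb hs
  have hbd : ∀ y, |npdf₁ y| ≤ 8 := fun y => (abs_npdf₁_le y).trans (by linarith [bump_le_one y])
  have hbd0 : ∀ y, ‖npdf y‖ ≤ 1 := fun y => by
    rw [Real.norm_eq_abs, abs_of_nonneg (npdf_nonneg y)]; exact npdf_le_one y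
  have hparts : ∫ y, npdf y * npdf₂ ((x - b * y) / s)
      = s / b * ∫ y, npdf₁ y * npdf₁ ((x - b * y) / s) := by
    have hp := integral_mul_deriv_eq_deriv_mul_of_integrable (u := npdf) (u' := npdf₁)
      (v := fun y => -(s / b) * npdf₁ ((x - b * y) / s))
      (v' := fun y => npdf₂ ((x - b * y) / s))
      (fun y _ => hasDerivAt_npdf y) (fun y _ => by
        refine HasDerivAt.congr_deriv (((hasDerivAt_npdf₁ _).comp y
          (hasDerivAt_sub_mul_div x b s y)).const_mul (-(s / b))) ?_
        field_simp)
      (hi2'.bdd_mul (c := 1) continuous_npdf.aestronglyMeasurable (Eventually.of_forall hbd0))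
      ((hi1'.const_mul _).bdd_mul (c := 8) continuous_npdf₁.aestronglyMeasurable
        (Eventually.of_forall hbd))
      ((hi1'.const_mul _).bdd_mul (c := 1) continuous_npdf.aestronglyMeasurable
        (Eventually.of_forall hbd0))
    rw [hp, ← integral_neg, ← integral_const_mul]
    refine integral_congr_ae (Eventually.of_forall fun t => ?_)
    simp only
    ring
  have h3 : |∫ y, npdf₁ y * npdf₁ ((x - b * y) / s)| ≤ s / b * (64 * Real.pi) := by
    rw [← integral_bump, ← integral_const_mul,
      ← integral_comp_sub_mul_div (fun y => 64 * bump y) x hb hs]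
    refine (abs_integral_le_integral_abs).trans (integral_mono_of_nonneg
      (Eventually.of_forall fun t => abs_nonneg _)
      (integrable_comp_sub_mul_div (integrable_bump.const_mul 64) x hb hs)
      (Eventually.of_forall fun t => ?_))
    simp only
    rw [abs_mul]
    calc _ ≤ 8 * (8 * bump ((x - b * t) / s)) :=
          mul_le_mul (hbd t) (abs_npdf₁_le _) (abs_nonneg _) (by norm_num)
      _ = _ := by ring
  have hδ0 : 0 ≤ δ := (abs_nonneg _).trans (hδ 0)
  have hpi := Real.pi_lt_four
  have h4 : |∫ y, npdf y * npdf₂ ((x - b * y) / s)| ≤ 256 * (s / b) ^ 2 := by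
    rw [hparts, abs_mul, abs_of_pos hsb]
    nlinarith
  have h5 : δ * ∫ t, |npdf₃ t| ≤ δ * 576 := by gcongr; linarith
  have h6 := abs_sub_abs_le_abs_sub (∫ y, npdf₂ ((x - b * y) / s) ∂P)
    (∫ y, npdf y * npdf₂ ((x - b * y) / s))
  nlinarith [sq_nonneg (s / b)]

/-! ### Removing a Gaussian smoothing -/

theorem exists_ncdf_quartiles : ∃ r : ℝ, 0 ≤ r ∧ 3 / 4 ≤ ncdf r ∧ ncdf (-r) ≤ 1 / 4 := by
  have h1 : ∀ᶠ r in atTop, (3 / 4 : ℝ) < ncdf r :=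
    (tendsto_cdf_atTop (gaussianReal 0 1)).eventually_const_lt (by norm_num)
  have h2 : ∀ᶠ r in atTop, ncdf (-r) < 1 / 4 :=
    ((tendsto_cdf_atBot (gaussianReal 0 1)).comp tendsto_neg_atTop_atBot).eventually_lt_const
      (by norm_num)
  obtain ⟨r, h0, h1, h2⟩ := ((eventually_ge_atTop (0 : ℝ)).and (h1.and h2)).exists
  exact ⟨r, h0, h1.le, h2.le⟩

/-- Both sides are the distribution function at x of Y + α N, with Y of law P and N an independent
standard normal variable. -/
theorem integral_ncdf_eq (P : Measure ℝ) [IsProbabilityMeasure P] (x : ℝ) {α : ℝ} (hα : 0 < α) :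
    ∫ y, ncdf ((x - y) / α) ∂P = ∫ y, npdf y * cdf P (x - α * y) := by
  rw [integral_eq_neg_integral_deriv_mul_cdf (g' := fun y => npdf ((x - y) / α) * (-1 / α)) P]
  · have h := integral_comp_sub_mul_div (fun y => npdf y * cdf P (x - α * y)) x one_pos hα
    have e : ∀ y, x - α * ((x - y) / α) = y := fun y => by field_simp; ring
    simp only [one_mul, e, div_one] at h
    have h2 : ∫ y, npdf y * cdf P (x - α * y) = α⁻¹ * ∫ y, npdf ((x - y) / α) * cdf P y := by
      rw [h, inv_mul_cancel_left₀ hα.ne']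
    rw [h2, ← integral_const_mul, ← integral_neg]
    refine integral_congr_ae (Eventually.of_forall fun t => ?_)
    simp only
    ring
  · intro y
    have := (hasDerivAt_ncdf ((x - 1 * y) / α)).comp y (hasDerivAt_sub_mul_div x 1 α y)
    simpa only [Function.comp_def, one_mul] using this
  · have := (integrable_comp_sub_mul_div integrable_npdf x one_pos hα).mul_const (-1 / α)
    simpa only [one_mul] using this
  · have := (tendsto_cdf_atBot (gaussianReal 0 1)).comp (tendsto_sub_mul_div_atBot x one_pos hα)
    simp only [Function.comp_def, one_mul] at this
    exact this

theorem integrable_npdf_mul {f : ℝ → ℝ} (hf : Measurable f) (h1 : ∀ y, |f y| ≤ 1) :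
    Integrable fun y => npdf y * f y :=
  integrable_npdf.mul_bdd (c := 1) hf.aestronglyMeasurable (Eventually.of_forall h1)

theorem integrable_npdf_mul_abs : Integrable fun y => npdf y * |y| := by
  have := (integrable_of_abs_le_bump continuous_npdf₁ abs_npdf₁_le).abs
  refine this.congr (Eventually.of_forall fun y => ?_)
  simp only
  rw [npdf₁, abs_mul, abs_neg, abs_of_nonneg (npdf_nonneg y), mul_comm]

theorem integral_npdf_mul_abs_le : ∫ y, npdf y * |y| ≤ 32 := by
  have h := integral_abs_le_of_abs_le_bump abs_npdf₁_le
  have e : ∫ y, npdf y * |y| = ∫ y, |npdf₁ y| := by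
    refine integral_congr_ae (Eventually.of_forall fun y => ?_)
    simp only
    rw [npdf₁, abs_mul, abs_neg, abs_of_nonneg (npdf_nonneg y), mul_comm]
  rw [e]
  linarith [Real.pi_lt_four]

theorem abs_cdf_sub_cdf_le (P Q : Measure ℝ) (y : ℝ) : |cdf P y - cdf Q y| ≤ 1 := by
  rw [abs_le]
  constructor <;> linarith [cdf_nonneg P y, cdf_le_one P y, cdf_nonneg Q y, cdf_le_one Q y]

theorem integral_npdf_Iic (r : ℝ) : ∫ y, npdf y * (Set.Iic r).indicator 1 y = ncdf r := by
  rw [ncdf_eq_integral, ← integral_indicator measurableSet_Iic]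
  refine integral_congr_ae (Eventually.of_forall fun y => ?_)
  by_cases hy : y ∈ Set.Iic r <;> simp [hy]

/-- Removal of a Gaussian smoothing at scale `α`. -/
theorem abs_cdf_sub_ncdf_le_of_smooth (P : Measure ℝ) [IsProbabilityMeasure P] {r α Δ : ℝ}
    (hr : 0 ≤ r) (hr1 : 3 / 4 ≤ ncdf r) (hr2 : ncdf (-r) ≤ 1 / 4) (hα : 0 < α)
    (hΔ : ∀ x, |∫ y, ncdf ((x - y) / α) ∂P - ncdf x| ≤ Δ) (x : ℝ) :
    |cdf P x - ncdf x| ≤ 2 * (Δ + (r + 64) * α) := by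
  set H : ℝ → ℝ := fun y => cdf P y - ncdf y with hH
  have hHm : Measurable H := (monotone_cdf P).measurable.sub ncdf_mono.measurable
  have hH1 : ∀ y, |H y| ≤ 1 := fun y => abs_cdf_sub_cdf_le _ _ y
  have hbdd : BddAbove (Set.range fun y => |H y|) := ⟨1, by rintro _ ⟨y, rfl⟩; exact hH1 y⟩
  set D := ⨆ y, |H y| with hD
  have hHD : ∀ y, |H y| ≤ D := fun y => le_ciSup hbdd y
  have hD0 : 0 ≤ D := (abs_nonneg _).trans (hHD 0)
  have hint : ∀ x, Integrable fun y => npdf y * H (x - α * y) := fun x =>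
    integrable_npdf_mul (hHm.comp (by fun_prop)) fun y => hH1 _
  have hsm : ∀ x, |∫ y, npdf y * H (x - α * y)| ≤ Δ + 32 * α := by
    intro x
    have i1 : Integrable fun y => npdf y * cdf P (x - α * y) :=
      integrable_npdf_mul ((monotone_cdf P).measurable.comp (by fun_prop)) fun y => by
        rw [abs_of_nonneg (cdf_nonneg _ _)]; exact cdf_le_one _ _
    have i2 : Integrable fun y => npdf y * ncdf (x - α * y) :=
      integrable_npdf_mul (ncdf_mono.measurable.comp (by fun_prop)) fun y => by
        rw [abs_of_nonneg (ncdf_nonneg _)]; exact ncdf_le_one _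
    have e1 : ∫ y, npdf y * H (x - α * y)
        = (∫ y, ncdf ((x - y) / α) ∂P - ncdf x) - ∫ y, npdf y * (ncdf (x - α * y) - ncdf x) := by
      rw [integral_ncdf_eq P x hα]
      simp_rw [hH, mul_sub]
      rw [integral_sub i1 i2, integral_sub i2 (integrable_npdf.mul_const _), integral_mul_const,
        integral_npdf]
      ring
    have e2 : |∫ y, npdf y * (ncdf (x - α * y) - ncdf x)| ≤ 32 * α := by
      calc _ ≤ ∫ y, |npdf y * (ncdf (x - α * y) - ncdf x)| := abs_integral_le_integral_abs
        _ ≤ ∫ y, npdf y * |y| * α := by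
            refine integral_mono_of_nonneg (Eventually.of_forall fun t => abs_nonneg _)
              (integrable_npdf_mul_abs.mul_const α) (Eventually.of_forall fun t => ?_)
            simp only
            rw [abs_mul, abs_of_nonneg (npdf_nonneg t), mul_assoc]
            refine mul_le_mul_of_nonneg_left ((abs_ncdf_sub_le _ _).trans_eq ?_) (npdf_nonneg t)
            rw [show x - α * t - x = -(α * t) by ring, abs_neg, abs_mul, abs_of_pos hα, mul_comm]
        _ ≤ 32 * α := by
            rw [integral_mul_const]
            exact mul_le_mul_of_nonneg_right integral_npdf_mul_abs_le hα.le
    rw [e1]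
    exact (abs_sub _ _).trans (add_le_add (hΔ x) e2)
  have habs : Integrable fun y => npdf y * (α * (r + |y|)) := by
    have := (integrable_npdf.mul_const (α * r)).add (integrable_npdf_mul_abs.mul_const α)
    refine this.congr (Eventually.of_forall fun y => ?_)
    simp only [Pi.add_apply]
    ring
  have habs' : ∫ y, npdf y * (α * (r + |y|)) ≤ α * (r + 32) := by
    have e : ∀ y, npdf y * (α * (r + |y|)) = npdf y * (α * r) + npdf y * |y| * α := fun y => by
      ring
    simp_rw [e]
    rw [integral_add (integrable_npdf.mul_const _) (integrable_npdf_mul_abs.mul_const α),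
      integral_mul_const, integral_mul_const, integral_npdf]
    have := integral_npdf_mul_abs_le
    nlinarith
  have hI : ∀ r, Integrable fun y => npdf y * (Set.Iic r).indicator 1 y := fun r =>
    integrable_npdf_mul (measurable_one.indicator measurableSet_Iic) fun y => by
      by_cases hy : y ∈ Set.Iic r <;> simp [hy]
  -- the integral of a step function `a` on `(-∞, ρ]`, `b` on `(ρ, ∞)`
  have hstep : ∀ a b ρ : ℝ, Integrable (fun y => npdf y * (b + (a - b) * (Set.Iic ρ).indicator 1 y))
      ∧ ∫ y, npdf y * (b + (a - b) * (Set.Iic ρ).indicator 1 y) = b + (a - b) * ncdf ρ := by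
    intro a b ρ
    have e : ∀ y, npdf y * (b + (a - b) * (Set.Iic ρ).indicator 1 y)
        = npdf y * b + npdf y * (Set.Iic ρ).indicator 1 y * (a - b) := fun y => by ring
    simp_rw [e]
    refine ⟨(integrable_npdf.mul_const _).add ((hI ρ).mul_const _), ?_⟩
    rw [integral_add (integrable_npdf.mul_const _) ((hI ρ).mul_const _), integral_mul_const,
      integral_mul_const, integral_npdf, integral_npdf_Iic]
    ring
  -- If H x is positive then H stays almost as large just to the right of x, because `cdf P`
  -- increases and Φ is 1-Lipschitz. Centring the smoothing at x + α r puts Gaussian mass at least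
  -- 3/4 on that side; on the rest H ≥ -D. One 32 α bounds the smoothing of Φ itself, the other the
  -- mean of α |y|.
  have hup : ∀ x, H x * (3 / 4) ≤ Δ + (r + 64) * α + D / 4 := by
    intro x
    by_cases hx : H x < 0
    · have : 0 ≤ Δ := (abs_nonneg _).trans (hΔ 0)
      nlinarith
    push Not at hx
    obtain ⟨hi, he⟩ := hstep (H x) (-D) r
    have hle : ∫ y, (npdf y * (-D + (H x - -D) * (Set.Iic r).indicator 1 y)
        - npdf y * (α * (r + |y|))) ≤ ∫ y, npdf y * H (x + α * r - α * y) := by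
      refine integral_mono (hi.sub habs) (hint _) fun y => ?_
      simp only
      rw [← mul_sub]
      refine mul_le_mul_of_nonneg_left ?_ (npdf_nonneg y)
      by_cases hy : y ≤ r
      · have h1 : cdf P x ≤ cdf P (x + α * r - α * y) := monotone_cdf P (by nlinarith)
        have h2 := (abs_le.1 (abs_ncdf_sub_le (x + α * r - α * y) x)).2
        rw [show x + α * r - α * y - x = α * (r - y) by ring,
          abs_of_nonneg (mul_nonneg hα.le (by linarith))] at h2
        have h3 : α * (r - y) ≤ α * (r + |y|) := by
          gcongr; linarith [neg_abs_le y]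
        simp only [Set.mem_Iic, hy, Set.indicator_of_mem, Pi.one_apply]
        simp only [hH]
        linarith
      · simp only [Set.mem_Iic, hy, not_false_eq_true, Set.indicator_of_notMem]
        have := (abs_le.1 (hHD (x + α * r - α * y))).1
        have : 0 ≤ α * (r + |y|) := by positivity
        linarith
    rw [integral_sub hi habs, he] at hle
    have := (abs_le.1 (hsm (x + α * r))).2
    nlinarith
  -- The mirror image, with the smoothing centred at x - α r.
  have hdown : ∀ x, -H x * (3 / 4) ≤ Δ + (r + 64) * α + D / 4 := by
    intro x
    by_cases hx : 0 < H x
    · have : 0 ≤ Δ := (abs_nonneg _).trans (hΔ 0)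
      nlinarith
    push Not at hx
    obtain ⟨hi, he⟩ := hstep D (H x) (-r)
    have hle : ∫ y, npdf y * H (x - α * r - α * y)
        ≤ ∫ y, (npdf y * (H x + (D - H x) * (Set.Iic (-r)).indicator 1 y)
        + npdf y * (α * (r + |y|))) := by
      refine integral_mono (hint _) (hi.add habs) fun y => ?_
      simp only
      rw [← mul_add]
      refine mul_le_mul_of_nonneg_left ?_ (npdf_nonneg y)
      by_cases hy : y ≤ -r
      · simp only [Set.mem_Iic, hy, Set.indicator_of_mem, Pi.one_apply]
        have := (abs_le.1 (hHD (x - α * r - α * y))).2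
        have : 0 ≤ α * (r + |y|) := by positivity
        linarith
      · simp only [Set.mem_Iic, hy, not_false_eq_true, Set.indicator_of_notMem]
        push Not at hy
        have h1 : cdf P (x - α * r - α * y) ≤ cdf P x := monotone_cdf P (by nlinarith)
        have h2 := (abs_le.1 (abs_ncdf_sub_le (x - α * r - α * y) x)).1
        rw [show x - α * r - α * y - x = -(α * (r + y)) by ring, abs_neg,
          abs_of_nonneg (mul_nonneg hα.le (by linarith))] at h2
        have h3 : α * (r + y) ≤ α * (r + |y|) := by
          gcongr; exact le_abs_self y
        simp only [hH]
        linarith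
    rw [integral_add hi habs, he] at hle
    have := (abs_le.1 (hsm (x - α * r))).1
    nlinarith
  -- The supremum reappears with factor 1/3 and is absorbed on the left.
  have hall : D ≤ 4 / 3 * (Δ + (r + 64) * α + D / 4) := by
    refine ciSup_le fun y => ?_
    rw [abs_le]
    constructor <;> linarith [hup y, hdown y]
  linarith [hHD x]

/-! ### Limiting moments of a step and the one-step expansion -/

/-- The limit of `ν₁(n) / n`. -/
noncomputable def nuLim (p : ℝ) : ℝ := p / (2 - p)

/-- The limit of the conditional variance of one step of `ν₁`. -/
noncomputable def stepVar (p : ℝ) : ℝ := 2 * p - nuLim p - nuLim p ^ 2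

/-- The limit of the conditional third central moment of one step of `ν₁`. -/
noncomputable def stepThird (p : ℝ) : ℝ :=
  nuLim p - 3 * (2 * p - nuLim p) * nuLim p + 2 * nuLim p ^ 3

section Constants

variable {p : ℝ}

/-- At ratio S_n / n = v the mean increment is v, so the line n v is an equilibrium of the drift. -/
theorem nuLim_eq (hp1 : p < 1) : p - (1 - p) * nuLim p = nuLim p := by
  unfold nuLim
  have : 2 - p ≠ 0 := by linarith
  field_simp
  ring

theorem nuLim_pos (hp0 : 0 < p) (hp1 : p < 1) : 0 < nuLim p := div_pos hp0 (by linarith)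

theorem nuLim_lt_one (hp1 : p < 1) : nuLim p < 1 := by
  rw [nuLim, div_lt_one (by linarith)]; linarith

/-- The origin of σ₁²: the martingale weights behave like (k/n)^{1-p}, and the sum of their squares
over k ≤ n is about n / (3 - 2p). -/
theorem sigmaOne_sq (hp0 : 0 < p) (hp1 : p < 1) :
    sigmaOne p ^ 2 * (3 - 2 * p) = stepVar p := by
  have h1 : 0 < 1 - p := by linarith
  have h2 : 0 < 3 - p := by linarith
  have h3 : 0 < 3 - 2 * p := by linarith
  have h4 : 0 < 2 - p := by linarith
  rw [sigmaOne, Real.sq_sqrt (by positivity), stepVar, nuLim]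
  field_simp
  ring

theorem sigmaOne_pos (hp0 : 0 < p) (hp1 : p < 1) : 0 < sigmaOne p := by
  have h1 : 0 < 1 - p := by linarith
  have h2 : 0 < 3 - p := by linarith
  have h3 : 0 < 3 - 2 * p := by linarith
  have h4 : 0 < 2 - p := by linarith
  exact Real.sqrt_pos.2 (by positivity)

theorem stepVar_le (hp0 : 0 < p) (hp1 : p < 1) : stepVar p ≤ 2 := by
  have := nuLim_pos hp0 hp1
  unfold stepVar
  nlinarith

theorem sigmaOne_sq_le (hp0 : 0 < p) (hp1 : p < 1) : sigmaOne p ^ 2 ≤ 2 := by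
  have := sigmaOne_sq hp0 hp1
  have := stepVar_le hp0 hp1
  nlinarith [sq_nonneg (sigmaOne p)]

theorem abs_stepThird_le (hp0 : 0 < p) (hp1 : p < 1) : |stepThird p| ≤ 6 := by
  have h0 := nuLim_pos hp0 hp1
  have h1 := nuLim_lt_one hp1
  have h2 : nuLim p ^ 3 ≤ 1 := pow_le_one₀ h0.le h1.le
  have h3 : 0 ≤ nuLim p ^ 3 := by positivity
  have h4 : nuLim p ^ 2 ≤ 1 := pow_le_one₀ h0.le h1.le
  have h5 : p * nuLim p ≤ 1 := by nlinarith
  have h6 : 0 ≤ p * nuLim p := by positivity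
  unfold stepThird
  rw [abs_le]
  constructor <;> nlinarith

end Constants

/-- Fourth-order expansion of `Φ` along a three-point distribution. -/
theorem abs_ncdf_mixture_le {z w₁ w₂ w₃ h₁ h₂ h₃ : ℝ} (hw₁ : 0 ≤ w₁) (hw₂ : 0 ≤ w₂) (hw₃ : 0 ≤ w₃)
    (hw : w₁ + w₂ + w₃ = 1) (hh₁ : |h₁| ≤ 1) (hh₂ : |h₂| ≤ 1) (hh₃ : |h₃| ≤ 1) :
    |w₁ * ncdf (z + h₁) + w₂ * ncdf (z + h₂) + w₃ * ncdf (z + h₃) - ncdf z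
        - (w₁ * h₁ + w₂ * h₂ + w₃ * h₃) * npdf z
        - (w₁ * h₁ ^ 2 + w₂ * h₂ ^ 2 + w₃ * h₃ ^ 2) / 2 * npdf₁ z
        - (w₁ * h₁ ^ 3 + w₂ * h₂ ^ 3 + w₃ * h₃ ^ 3) / 6 * npdf₂ z|
      ≤ 432 * bump z * (w₁ * h₁ ^ 4 + w₂ * h₂ ^ 4 + w₃ * h₃ ^ 4) := by
  have e₁ := abs_ncdf_taylor_le (z := z) hh₁
  have e₂ := abs_ncdf_taylor_le (z := z) hh₂
  have e₃ := abs_ncdf_taylor_le (z := z) hh₃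
  set r₁ := ncdf (z + h₁) - ncdf z - h₁ * npdf z - h₁ ^ 2 / 2 * npdf₁ z - h₁ ^ 3 / 6 * npdf₂ z
    with hr₁
  set r₂ := ncdf (z + h₂) - ncdf z - h₂ * npdf z - h₂ ^ 2 / 2 * npdf₁ z - h₂ ^ 3 / 6 * npdf₂ z
    with hr₂
  set r₃ := ncdf (z + h₃) - ncdf z - h₃ * npdf z - h₃ ^ 2 / 2 * npdf₁ z - h₃ ^ 3 / 6 * npdf₂ z
    with hr₃
  have e : w₁ * ncdf (z + h₁) + w₂ * ncdf (z + h₂) + w₃ * ncdf (z + h₃) - ncdf z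
        - (w₁ * h₁ + w₂ * h₂ + w₃ * h₃) * npdf z
        - (w₁ * h₁ ^ 2 + w₂ * h₂ ^ 2 + w₃ * h₃ ^ 2) / 2 * npdf₁ z
        - (w₁ * h₁ ^ 3 + w₂ * h₂ ^ 3 + w₃ * h₃ ^ 3) / 6 * npdf₂ z
      = w₁ * r₁ + w₂ * r₂ + w₃ * r₃ := by
    rw [hr₁, hr₂, hr₃]
    linear_combination (ncdf z) * hw
  rw [e]
  calc |w₁ * r₁ + w₂ * r₂ + w₃ * r₃| ≤ |w₁ * r₁| + |w₂ * r₂| + |w₃ * r₃| := abs_add_three _ _ _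
    _ = w₁ * |r₁| + w₂ * |r₂| + w₃ * |r₃| := by
        rw [abs_mul, abs_mul, abs_mul, abs_of_nonneg hw₁, abs_of_nonneg hw₂, abs_of_nonneg hw₃]
    _ ≤ w₁ * (432 * bump z * h₁ ^ 4) + w₂ * (432 * bump z * h₂ ^ 4)
        + w₃ * (432 * bump z * h₃ ^ 4) := by gcongr
    _ = _ := by ring

/-- The first three moments of a centred step of the chain. -/
theorem step_moments {p q v y d : ℝ} (hp : p = v + q * v) (hpq : q = 1 - p) :
    p * -(d * (1 - v + q * y)) + q * (v + y) * -(d * (-1 - v + q * y))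
      + q * (1 - (v + y)) * -(d * (-v + q * y)) = 0 ∧
    p * (-(d * (1 - v + q * y))) ^ 2 + q * (v + y) * (-(d * (-1 - v + q * y))) ^ 2
      + q * (1 - (v + y)) * (-(d * (-v + q * y))) ^ 2
      = d ^ 2 * (2 * p - v - v ^ 2 + y * (q * (1 + 2 * v) - q ^ 2 * y)) ∧
    p * (-(d * (1 - v + q * y))) ^ 3 + q * (v + y) * (-(d * (-1 - v + q * y))) ^ 3
      + q * (1 - (v + y)) * (-(d * (-v + q * y))) ^ 3
      = -(d ^ 3 * (v - 3 * (2 * p - v) * v + 2 * v ^ 3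
        + y * (-q + 3 * (2 * p - v) * q - 3 * q * v + 3 * q ^ 2 * y
        - 6 * v ^ 2 * q + 6 * v * q ^ 2 * y - 2 * q ^ 3 * y ^ 2))) := by
  have hw : q * (1 - (v + y)) = 1 - p - q * (v + y) := by rw [mul_sub, mul_one]; linarith
  rw [hw]
  clear hw hpq
  subst hp
  refine ⟨by ring, by ring, by ring⟩

theorem abs_third_moment_coeff_le {p q v y : ℝ} (hp0 : 0 ≤ p) (hp1 : p ≤ 1) (hq0 : 0 ≤ q)
    (hq1 : q ≤ 1) (hv0 : 0 ≤ v) (hv1 : v ≤ 1) (hy : |y| ≤ 1) :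
    |-q + 3 * (2 * p - v) * q - 3 * q * v + 3 * q ^ 2 * y
        - 6 * v ^ 2 * q + 6 * v * q ^ 2 * y - 2 * q ^ 3 * y ^ 2| ≤ 27 := by
  have h1 : 0 ≤ p * q ∧ p * q ≤ 1 := ⟨by positivity, mul_le_one₀ hp1 hq0 hq1⟩
  have h2 : 0 ≤ q * v ∧ q * v ≤ 1 := ⟨by positivity, mul_le_one₀ hq1 hv0 hv1⟩
  have hq2 : q ^ 2 ≤ 1 := pow_le_one₀ hq0 hq1
  have hq3 : q ^ 3 ≤ 1 := pow_le_one₀ hq0 hq1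
  have hv2 : v ^ 2 ≤ 1 := pow_le_one₀ hv0 hv1
  have h3 : 0 ≤ v ^ 2 * q ∧ v ^ 2 * q ≤ 1 := ⟨by positivity, mul_le_one₀ hv2 hq0 hq1⟩
  have h4 : |q ^ 2 * y| ≤ 1 := by
    rw [abs_mul, abs_of_nonneg (by positivity : 0 ≤ q ^ 2)]
    exact mul_le_one₀ hq2 (abs_nonneg _) hy
  have h5 : |v * (q ^ 2 * y)| ≤ 1 := by
    rw [abs_mul, abs_of_nonneg hv0]
    exact mul_le_one₀ hv1 (abs_nonneg _) h4
  have h6 : 0 ≤ q ^ 3 * y ^ 2 ∧ q ^ 3 * y ^ 2 ≤ 1 :=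
    ⟨by positivity, mul_le_one₀ hq3 (sq_nonneg _) ((sq_le_one_iff_abs_le_one y).2 hy)⟩
  rw [abs_le] at h4 h5 ⊢
  constructor <;> linarith [h1.1, h1.2, h2.1, h2.2, h3.1, h3.2, h4.1, h4.2, h5.1, h5.2, h6.1, h6.2]

set_option maxHeartbeats 400000 in
/-- The effect of one step of the chain on `Φ`, compared with the heat flow. Here `y` is the
deviation of `ν₁(k) / k` from its limit. -/
theorem abs_ncdf_step_le {p : ℝ} (hp0 : 0 < p) (hp1 : p < 1) {y z d e κ : ℝ}
    (hy0 : 0 ≤ nuLim p + y) (hy1 : nuLim p + y ≤ 1) (hd0 : 0 ≤ d) (hd1 : d ≤ 1 / 2)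
    (he0 : 0 ≤ e) (he1 : e ≤ stepVar p) (heκ : e ≤ 2 * κ) :
    |p * ncdf (z - d * (1 - nuLim p + (1 - p) * y))
        + (1 - p) * (nuLim p + y) * ncdf (z - d * (-1 - nuLim p + (1 - p) * y))
        + (1 - p) * (1 - (nuLim p + y)) * ncdf (z - d * (-nuLim p + (1 - p) * y))
        - ncdf (z / √(1 + d ^ 2 * (stepVar p - e))) + stepThird p * d ^ 3 / 6 * npdf₂ z|
      ≤ 40 * d ^ 2 * ((|y| + κ) * bump z) + 8000 * d ^ 4 * bump z := by
  have hv0 := nuLim_pos hp0 hp1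
  have hv1 := nuLim_lt_one hp1
  have hv := nuLim_eq hp1
  have hs2 := stepVar_le hp0 hp1
  have hthird : stepThird p
    = nuLim p - 3 * (2 * p - nuLim p) * nuLim p + 2 * nuLim p ^ 3 := rfl
  have hsv : stepVar p = 2 * p - nuLim p - nuLim p ^ 2 := rfl
  set v := nuLim p with hvdef
  obtain ⟨q, hq⟩ : ∃ q, q = 1 - p := ⟨_, rfl⟩
  rw [← hq] at hv ⊢
  have hq0 : 0 < q := by linarith
  have hq1 : q < 1 := by linarith
  have hyabs : |y| ≤ 1 := by rw [abs_le]; constructor <;> linarith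
  obtain ⟨hyl, hyu⟩ := abs_le.1 hyabs
  have hqy : |q * y| ≤ 1 := by
    rw [abs_mul, abs_of_pos hq0]; exact mul_le_one₀ hq1.le (abs_nonneg y) hyabs
  obtain ⟨hqyl, hqyu⟩ := abs_le.1 hqy
  -- the three increments
  have hμ0 : v - q * y ≤ 1 := by
    have h1 : 0 ≤ q * (v + y) := by positivity
    linarith
  have hμ1 : -1 ≤ v - q * y := by linarith
  -- A raw increment and its conditional mean v - q y both lie in [-1, 1], so a centred increment
  -- has size at most 2; d ≤ 1/2 then keeps the shift within the range of the Taylor bound.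
  have hζ : ∀ ζ : ℝ, |ζ| ≤ 2 → |-(d * ζ)| ≤ 1 ∧ (-(d * ζ)) ^ 4 ≤ 16 * d ^ 4 := by
    intro ζ hζ
    constructor
    · rw [abs_neg, abs_mul, abs_of_nonneg hd0]; nlinarith [abs_nonneg ζ]
    · have : ζ ^ 4 ≤ 16 := by
        rw [← Even.pow_abs (by decide : Even 4)]
        calc |ζ| ^ 4 ≤ 2 ^ 4 := by gcongr
          _ = 16 := by norm_num
      calc (-(d * ζ)) ^ 4 = ζ ^ 4 * d ^ 4 := by ring
        _ ≤ 16 * d ^ 4 := by gcongr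
  obtain ⟨a1, b1⟩ := hζ (1 - v + q * y) (by rw [abs_le]; constructor <;> linarith)
  obtain ⟨a2, b2⟩ := hζ (-1 - v + q * y) (by rw [abs_le]; constructor <;> linarith)
  obtain ⟨a3, b3⟩ := hζ (-v + q * y) (by rw [abs_le]; constructor <;> linarith)
  have hw2 : 0 ≤ q * (v + y) := by positivity
  have hw3 : 0 ≤ q * (1 - (v + y)) := mul_nonneg hq0.le (by linarith)
  have hw : p + q * (v + y) + q * (1 - (v + y)) = 1 := by rw [hq]; ring
  have hmix := abs_ncdf_mixture_le (z := z) hp0.le hw2 hw3 hw a1 a2 a3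
  have hheat := abs_ncdf_div_sqrt_le (z := z) (r := d ^ 2 * (stepVar p - e))
    (mul_nonneg (sq_nonneg d) (by linarith)) (by
      have h1 : d ^ 2 ≤ (1 / 2) ^ 2 := by gcongr
      calc d ^ 2 * (stepVar p - e) ≤ (1 / 2) ^ 2 * 2 := by gcongr; linarith
        _ ≤ 1 := by norm_num)
  simp only [← sub_eq_add_neg] at hmix
  obtain ⟨m1, m2, m3⟩ := step_moments (d := d) (y := y) (show p = v + q * v by linarith) hq
  rw [← hsv] at m2
  rw [← hthird] at m3
  have hR3b := abs_third_moment_coeff_le hp0.le hp1.le hq0.le hq1.le hv0.le hv1.le hyabs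
  rw [m1, m2, m3] at hmix
  set R3 := -q + 3 * (2 * p - v) * q - 3 * q * v + 3 * q ^ 2 * y
        - 6 * v ^ 2 * q + 6 * v * q ^ 2 * y - 2 * q ^ 3 * y ^ 2 with hR3
  set R2 := q * (1 + 2 * v) - q ^ 2 * y with hR2
  have hR2b : |R2| ≤ 4 := by
    have : |q ^ 2 * y| ≤ 1 := by
      rw [abs_mul, abs_of_nonneg (by positivity : 0 ≤ q ^ 2)]
      exact mul_le_one₀ (pow_le_one₀ hq0.le hq1.le) (abs_nonneg _) hyabs
    obtain ⟨h1, h2⟩ := abs_le.1 this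
    have h3 : 0 ≤ q * v := by positivity
    have h4 : q * v ≤ 1 := mul_le_one₀ hq1.le hv0.le hv1.le
    rw [hR2, abs_le]; constructor <;> linarith
  set F := p * ncdf (z - d * (1 - v + q * y)) + q * (v + y) * ncdf (z - d * (-1 - v + q * y))
        + q * (1 - (v + y)) * ncdf (z - d * (-v + q * y)) with hF
  set H := ncdf (z / √(1 + d ^ 2 * (stepVar p - e))) with hH
  have hb := bump_pos z
  have hn1 := abs_npdf₁_le z
  have hn2 := abs_npdf₂_le z
  have hE4 : 432 * bump z * (p * (-(d * (1 - v + q * y))) ^ 4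
      + q * (v + y) * (-(d * (-1 - v + q * y))) ^ 4
      + q * (1 - (v + y)) * (-(d * (-v + q * y))) ^ 4) ≤ 6912 * d ^ 4 * bump z := by
    calc _ ≤ 432 * bump z * (p * (16 * d ^ 4) + q * (v + y) * (16 * d ^ 4)
          + q * (1 - (v + y)) * (16 * d ^ 4)) := by gcongr
      _ = 6912 * d ^ 4 * bump z * (p + q * (v + y) + q * (1 - (v + y))) := by ring
      _ = _ := by rw [hw, mul_one]
  have hE2 : 200 * bump z * (d ^ 2 * (stepVar p - e)) ^ 2 ≤ 800 * d ^ 4 * bump z := by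
    have h1 : (stepVar p - e) ^ 2 ≤ 4 := by
      have := pow_le_pow_left₀ (show 0 ≤ stepVar p - e by linarith)
        (show stepVar p - e ≤ 2 by linarith) 2
      linarith
    calc _ = 200 * bump z * d ^ 4 * (stepVar p - e) ^ 2 := by ring
      _ ≤ 200 * bump z * d ^ 4 * 4 := by gcongr
      _ = _ := by ring
  have hκ : 0 ≤ κ := by linarith
  have hE1 : |d ^ 2 * (y * R2 + e) / 2 * npdf₁ z| ≤ 16 * d ^ 2 * ((|y| + κ) * bump z) := by
    rw [abs_mul, abs_div, abs_mul, abs_of_nonneg (sq_nonneg d),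
      abs_of_pos (by norm_num : (0:ℝ) < 2)]
    have : |y * R2 + e| ≤ 4 * (|y| + κ) := by
      calc |y * R2 + e| ≤ |y * R2| + |e| := abs_add_le _ _
        _ = |y| * |R2| + e := by rw [abs_mul, abs_of_nonneg he0]
        _ ≤ |y| * 4 + 2 * κ := by gcongr
        _ ≤ _ := by linarith
    calc d ^ 2 * |y * R2 + e| / 2 * |npdf₁ z|
        ≤ d ^ 2 * (4 * (|y| + κ)) / 2 * (8 * bump z) := by gcongr
      _ = _ := by ring
  have hE3 : |d ^ 3 * (y * R3) / 6 * npdf₂ z| ≤ 24 * d ^ 2 * ((|y| + κ) * bump z) := by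
    rw [abs_mul, abs_div, abs_mul, abs_of_nonneg (by positivity : 0 ≤ d ^ 3), abs_mul,
      abs_of_pos (by norm_num : (0:ℝ) < 6)]
    calc d ^ 3 * (|y| * |R3|) / 6 * |npdf₂ z|
        ≤ d ^ 3 * ((|y| + κ) * 27) / 6 * (8 * bump z) := by gcongr; linarith
      _ = d * (36 * d ^ 2 * ((|y| + κ) * bump z)) := by ring
      _ ≤ 1 / 2 * (36 * d ^ 2 * ((|y| + κ) * bump z)) := by gcongr
      _ ≤ _ := by
        have : 0 ≤ d ^ 2 * ((|y| + κ) * bump z) := by positivity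
        linarith
  have hm := hmix.trans hE4
  have hh := hheat.trans hE2
  -- The limiting second-moment terms of the step and of the heat flow cancel. What survives is the
  -- two Taylor remainders (6912 + 800 ≤ 8000) and the deviations of the second and third moments
  -- from their limits (16 + 24 = 40).
  have e4 : F - H + stepThird p * d ^ 3 / 6 * npdf₂ z
      = (F - ncdf z - 0 * npdf z - d ^ 2 * (stepVar p + y * R2) / 2 * npdf₁ z
          - -(d ^ 3 * (stepThird p + y * R3)) / 6 * npdf₂ z)
        - (H - ncdf z - d ^ 2 * (stepVar p - e) / 2 * npdf₁ z)
        + d ^ 2 * (y * R2 + e) / 2 * npdf₁ z - d ^ 3 * (y * R3) / 6 * npdf₂ z := by ring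
  rw [e4]
  have hd4 : 0 ≤ d ^ 4 * bump z := by positivity
  rw [abs_le] at hm hh hE1 hE3 ⊢
  constructor <;> linarith [hm.1, hm.2, hh.1, hh.2, hE1.1, hE1.2, hE3.1, hE3.2]

/-! ### The chain, its martingale weights and the remaining variance -/

/-- The law of the process `ν₁`: from `m` at time `n` it moves to `m + 1` with probability `p`, to
`m - 1` with probability `(1 - p) m / n`, and stays put otherwise. -/
structure IsSingletonChain {Ω : Type*} [MeasurableSpace Ω] (μ : Measure Ω) (p : ℝ)
    (S : ℕ → Ω → ℕ) : Prop where
  measurable : ∀ n, 1 ≤ n → Measurable (S n)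
  le : ∀ n, 1 ≤ n → ∀ ω, S n ω ≤ n
  start : ∀ ω, S 1 ω = 1
  step : ∀ n, 1 ≤ n → ∀ f : ℝ → ℝ, ∫ ω, f (S (n + 1) ω) ∂μ =
    ∫ ω, (p * f (S n ω + 1) + (1 - p) * ((S n ω : ℝ) / n) * f (S n ω - 1)
      + (1 - p) * (1 - (S n ω : ℝ) / n) * f (S n ω)) ∂μ

/-- The coefficient that turns `ν₁(k) - k p / (2 - p)`, `k ≤ n`, into a martingale. -/
noncomputable def decay (p : ℝ) (n k : ℕ) : ℝ := ∏ j ∈ Finset.Ico k n, (1 - (1 - p) / (j : ℝ))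

section Decay

variable {p : ℝ}

theorem decay_self (p : ℝ) (n : ℕ) : decay p n n = 1 := by simp [decay]

theorem decay_eq_mul {n k : ℕ} (hk : k < n) :
    decay p n k = (1 - (1 - p) / (k : ℝ)) * decay p n (k + 1) := by
  rw [decay, Finset.prod_eq_prod_Ico_succ_bot hk, decay]

theorem decay_factor_mem (hp0 : 0 < p) (hp1 : p < 1) {j : ℕ} (hj : 1 ≤ j) :
    0 ≤ 1 - (1 - p) / (j : ℝ) ∧ 1 - (1 - p) / (j : ℝ) ≤ 1 := by
  have hj' : (1 : ℝ) ≤ j := by exact_mod_cast hj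
  have h1 : (1 - p) / (j : ℝ) ≤ 1 := (div_le_one (by linarith)).2 (by linarith)
  have h2 : 0 ≤ (1 - p) / (j : ℝ) := div_nonneg (by linarith) (by linarith)
  constructor <;> linarith

theorem decay_nonneg (hp0 : 0 < p) (hp1 : p < 1) {n k : ℕ} (hk : 1 ≤ k) : 0 ≤ decay p n k :=
  Finset.prod_nonneg fun _ hj =>
    (decay_factor_mem hp0 hp1 (hk.trans (Finset.mem_Ico.1 hj).1)).1

theorem decay_le_one (hp0 : 0 < p) (hp1 : p < 1) {n k : ℕ} (hk : 1 ≤ k) : decay p n k ≤ 1 :=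
  Finset.prod_le_one
    (fun _ hj => (decay_factor_mem hp0 hp1 (hk.trans (Finset.mem_Ico.1 hj).1)).1)
    fun _ hj => (decay_factor_mem hp0 hp1 (hk.trans (Finset.mem_Ico.1 hj).1)).2

theorem le_decay (hp0 : 0 < p) (hp1 : p < 1) {n k : ℕ} (hk : 1 ≤ k) (hkn : k ≤ n) :
    p * k / n ≤ decay p n k := by
  have hk' : (1 : ℝ) ≤ k := by exact_mod_cast hk
  -- The right-hand side is nondecreasing in n, since (1 - q/n)(n + 1 - q) ≥ n - q for q = 1 - p.
  -- This linear lower bound replaces the true order (k/n)^{1-p} and is enough when k ≥ n/2.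
  have key : (k : ℝ) - (1 - p) ≤ decay p n k * (n - (1 - p)) := by
    induction n, hkn using Nat.le_induction with
    | base => rw [decay_self, one_mul]
    | succ n hn ih =>
      have hn' : (1 : ℝ) ≤ n := by exact_mod_cast hk.trans hn
      have e : decay p (n + 1) k = decay p n k * (1 - (1 - p) / (n : ℝ)) := by
        rw [decay, Finset.prod_Ico_succ_top hn, decay]
      have h0 := decay_nonneg hp0 hp1 (n := n) hk
      refine ih.trans ?_
      rw [e, mul_assoc]
      refine mul_le_mul_of_nonneg_left ?_ h0
      rw [one_sub_div (by linarith : (n : ℝ) ≠ 0), div_mul_eq_mul_div, le_div_iff₀ (by linarith)]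
      push_cast
      nlinarith
  have hn' : (1 : ℝ) ≤ n := hk'.trans (by exact_mod_cast hkn)
  rw [div_le_iff₀ (by linarith)]
  have h0 := decay_nonneg hp0 hp1 (n := n) hk
  nlinarith

end Decay

/-- The variance still to come after time `k`, with an extra smoothing `A`. -/
noncomputable def remVar (p A : ℝ) (n k : ℕ) : ℝ :=
  A + sigmaOne p ^ 2 * (n - k * decay p n k ^ 2)

/-- The heat-flow interpolation between `Φ` and the smoothed distribution function of `ν₁(n)`. -/
noncomputable def testFn (p A x : ℝ) (n k : ℕ) (m : ℝ) : ℝ :=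
  ncdf ((x - decay p n k * (m - k * nuLim p)) / √(remVar p A n k))

theorem le_remVar {p A : ℝ} (hp0 : 0 < p) (hp1 : p < 1) {n k : ℕ} (hk : 1 ≤ k) :
    A + sigmaOne p ^ 2 * (n - k) ≤ remVar p A n k := by
  have h0 := decay_nonneg hp0 hp1 (n := n) hk
  have h1 := decay_le_one hp0 hp1 (n := n) hk
  have h2 : decay p n k ^ 2 ≤ 1 := pow_le_one₀ h0 h1
  have hk' : (0 : ℝ) ≤ k := by positivity
  unfold remVar
  gcongr
  nlinarith

/-- From k c_k² = c_{k+1}² (k - 2q + q²/k) with q = 1 - p, the drop is σ₁² c_{k+1}² (1 + 2q - q²/k),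
and 1 + 2q = 3 - 2p. Thus `remVar` loses the limiting step variance up to a relative error O(1/k).
-/
theorem remVar_step {p A : ℝ} (hp0 : 0 < p) (hp1 : p < 1) {n k : ℕ} (hk : 1 ≤ k) (hkn : k < n) :
    remVar p A n k = remVar p A n (k + 1)
      + decay p n (k + 1) ^ 2 * (stepVar p - sigmaOne p ^ 2 * (1 - p) ^ 2 / k) := by
  have hk' : (k : ℝ) ≠ 0 := by positivity
  rw [← sigmaOne_sq hp0 hp1, remVar, remVar, decay_eq_mul hkn]
  push_cast
  field_simp
  ring

/-! ### Second moment of the chain and the mean error of one replacement step -/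

namespace IsSingletonChain

variable {Ω : Type*} [MeasurableSpace Ω] {μ : Measure Ω} {p : ℝ}
  {S : ℕ → Ω → ℕ}

theorem measurable_comp (h : IsSingletonChain μ p S) {k : ℕ} (hk : 1 ≤ k) (g : ℝ → ℝ) :
    Measurable fun ω => g (S k ω) :=
  (measurable_from_nat (f := fun m : ℕ => g m)).comp (h.measurable k hk)

theorem integrable_comp [IsProbabilityMeasure μ] (h : IsSingletonChain μ p S) {k : ℕ}
    (hk : 1 ≤ k) (g : ℝ → ℝ) : Integrable (fun ω => g (S k ω)) μ := by
  refine Integrable.of_bound (h.measurable_comp hk g).aestronglyMeasurable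
    (∑ m ∈ Finset.range (k + 1), |g m|) (Eventually.of_forall fun ω => ?_)
  exact Finset.single_le_sum (f := fun m : ℕ => |g m|) (fun m _ => abs_nonneg _)
    (Finset.mem_range.2 (Nat.lt_succ_of_le (h.le k hk ω)))

theorem ratio_mem (h : IsSingletonChain μ p S) {k : ℕ} (hk : 1 ≤ k) (ω : Ω) :
    0 ≤ (S k ω : ℝ) / k ∧ (S k ω : ℝ) / k ≤ 1 := by
  have h1 : (S k ω : ℝ) ≤ k := by exact_mod_cast h.le k hk ω
  exact ⟨by positivity, div_le_one_of_le₀ h1 (by positivity)⟩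

theorem integral_sq_le [IsProbabilityMeasure μ] (h : IsSingletonChain μ p S) (hp0 : 0 < p)
    (hp1 : p < 1) {n : ℕ} (hn : 1 ≤ n) : ∫ ω, ((S n ω : ℝ) - n * nuLim p) ^ 2 ∂μ ≤ 4 * n := by
  have hv0 := nuLim_pos hp0 hp1
  have hv1 := nuLim_lt_one hp1
  have hv := nuLim_eq hp1
  induction n, hn using Nat.le_induction with
  | base =>
    simp only [h.start, Nat.cast_one, one_mul, integral_const, probReal_univ, one_smul]
    nlinarith
  | succ n hn ih =>
    have hst := h.step n hn (fun m => (m - (n + 1 : ℕ) * nuLim p) ^ 2)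
    rw [hst]
    have hle : ∫ ω, (p * ((S n ω : ℝ) + 1 - (n + 1 : ℕ) * nuLim p) ^ 2
        + (1 - p) * ((S n ω : ℝ) / n) * ((S n ω : ℝ) - 1 - (n + 1 : ℕ) * nuLim p) ^ 2
        + (1 - p) * (1 - (S n ω : ℝ) / n) * ((S n ω : ℝ) - (n + 1 : ℕ) * nuLim p) ^ 2) ∂μ
        ≤ ∫ ω, (((S n ω : ℝ) - n * nuLim p) ^ 2 + 4) ∂μ := by
      refine integral_mono (h.integrable_comp hn fun m => p * (m + 1 - (n + 1 : ℕ) * nuLim p) ^ 2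
        + (1 - p) * (m / n) * (m - 1 - (n + 1 : ℕ) * nuLim p) ^ 2
        + (1 - p) * (1 - m / n) * (m - (n + 1 : ℕ) * nuLim p) ^ 2)
        (h.integrable_comp hn fun m => (m - n * nuLim p) ^ 2 + 4) fun ω => ?_
      simp only
      obtain ⟨hw0, hw1⟩ := h.ratio_mem hn ω
      have hn' : (1 : ℝ) ≤ n := by exact_mod_cast hn
      obtain ⟨w, hw⟩ : ∃ w, w = (S n ω : ℝ) / n := ⟨_, rfl⟩
      have hS : (S n ω : ℝ) = n * w := by rw [hw]; field_simp
      rw [← hw] at hw0 hw1 ⊢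
      rw [hS]
      push_cast
      set v := nuLim p
      have hq : 0 < 1 - p := by linarith
      -- The drift points back to n v, so the cross term is nonpositive; each step adds at most 4 to
      -- the second moment.
      have e1 : p * (n * w + 1 - (n + 1) * v) ^ 2
          + (1 - p) * w * (n * w - 1 - (n + 1) * v) ^ 2
          + (1 - p) * (1 - w) * (n * w - (n + 1) * v) ^ 2
          = (n * w - n * v) ^ 2 - 2 * n * ((1 - p) * (w - v) ^ 2)
            + (p * (1 - v) ^ 2 + (1 - p) * w * (1 + v) ^ 2 + (1 - p) * (1 - w) * v ^ 2) := by
        linear_combination (2 * n * (w - v)) * hv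
      have e2 : p * (1 - v) ^ 2 + (1 - p) * w * (1 + v) ^ 2 + (1 - p) * (1 - w) * v ^ 2
          ≤ p * 4 + (1 - p) * w * 4 + (1 - p) * (1 - w) * 4 := by
        have a1 : (1 - v) ^ 2 ≤ 4 := by nlinarith
        have a2 : (1 + v) ^ 2 ≤ 4 := by nlinarith
        have a3 : v ^ 2 ≤ 4 := by nlinarith
        have : 0 ≤ 1 - w := by linarith
        gcongr
      have e3 : 0 ≤ 2 * n * ((1 - p) * (w - v) ^ 2) := by positivity
      rw [e1]
      linarith
    refine hle.trans ?_
    rw [integral_add (h.integrable_comp hn fun m => (m - n * nuLim p) ^ 2) (integrable_const _)]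
    simp only [integral_const, probReal_univ, one_smul]
    push_cast
    linarith

theorem integral_ratio_sq_le [IsProbabilityMeasure μ] (h : IsSingletonChain μ p S)
    (hp0 : 0 < p) (hp1 : p < 1) {k : ℕ} (hk : 1 ≤ k) :
    ∫ ω, (|(S k ω : ℝ) / k - nuLim p| + 1 / k) ^ 2 ∂μ ≤ (10 / k : ℝ) := by
  have hk' : (1 : ℝ) ≤ k := by exact_mod_cast hk
  have h1 := h.integral_sq_le hp0 hp1 hk
  calc ∫ ω, (|(S k ω : ℝ) / k - nuLim p| + 1 / k) ^ 2 ∂μ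
      ≤ ∫ ω, (((S k ω : ℝ) - k * nuLim p) ^ 2 * (2 / k ^ 2) + 2 / k ^ 2) ∂μ := by
        refine integral_mono (h.integrable_comp hk fun m => (|m / k - nuLim p| + 1 / k) ^ 2)
          (h.integrable_comp hk fun m => (m - k * nuLim p) ^ 2 * (2 / k ^ 2) + 2 / k ^ 2)
          fun ω => ?_
        simp only
        have e : ((S k ω : ℝ) - k * nuLim p) ^ 2 * (2 / k ^ 2) + 2 / k ^ 2
            = 2 * |(S k ω : ℝ) / k - nuLim p| ^ 2 + 2 * (1 / k) ^ 2 := by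
          rw [sq_abs]; field_simp
        rw [e]
        exact (add_sq_le).trans_eq (by ring)
    _ = (∫ ω, ((S k ω : ℝ) - k * nuLim p) ^ 2 ∂μ) * (2 / k ^ 2) + 2 / k ^ 2 := by
        rw [integral_add (h.integrable_comp hk fun m => (m - k * nuLim p) ^ 2 * (2 / k ^ 2))
          (integrable_const _), integral_mul_const]
        simp
    _ ≤ 4 * k * (2 / k ^ 2) + 2 / k ^ 2 := by gcongr
    _ ≤ 10 / k := by
        have : 2 / (k : ℝ) ^ 2 ≤ 2 / k := by
          gcongr; nlinarith
        have e : 4 * (k : ℝ) * (2 / k ^ 2) = 8 / k := by field_simp; norm_num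
        rw [e]
        calc 8 / (k : ℝ) + 2 / k ^ 2 ≤ 8 / k + 2 / k := by gcongr
          _ = 10 / k := by ring

/-- The pointwise bound `abs_ncdf_step_le` is averaged over S_k. The third-moment term stays inside
the expectation with its sign, so that cancellation in the mean of φ'' can still be used. -/
theorem abs_integral_testFn_step_le [IsProbabilityMeasure μ] (h : IsSingletonChain μ p S)
    (hp0 : 0 < p) (hp1 : p < 1) {A x : ℝ} (hA : 4 ≤ A) {n k : ℕ} (hk : 1 ≤ k) (hkn : k < n) {d : ℝ}
    (hd : d = decay p n (k + 1) / √(remVar p A n (k + 1))) {z : ℝ → ℝ}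
    (hz : z = fun m => (x - decay p n k * (m - k * nuLim p)) / √(remVar p A n (k + 1))) :
    |∫ ω, testFn p A x n (k + 1) (S (k + 1) ω) ∂μ - ∫ ω, testFn p A x n k (S k ω) ∂μ|
      ≤ d ^ 3 * |∫ ω, npdf₂ (z (S k ω)) ∂μ|
        + 40 * d ^ 2 * ∫ ω, (|(S k ω : ℝ) / k - nuLim p| + 1 / k) * bump (z (S k ω)) ∂μ
        + 8000 * d ^ 4 * ∫ ω, bump (z (S k ω)) ∂μ := by
  have hk' : (1 : ℝ) ≤ k := by exact_mod_cast hk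
  have hc0 := decay_nonneg hp0 hp1 (n := n) (show 1 ≤ k + 1 by omega)
  have hc1 := decay_le_one hp0 hp1 (n := n) (show 1 ≤ k + 1 by omega)
  have hT := le_remVar (A := A) hp0 hp1 (n := n) (show 1 ≤ k + 1 by omega)
  have hkn' : ((k + 1 : ℕ) : ℝ) ≤ n := by exact_mod_cast hkn
  have hT4 : 4 ≤ remVar p A n (k + 1) := by
    nlinarith [sq_nonneg (sigmaOne p)]
  have hstep := remVar_step (A := A) hp0 hp1 hk hkn
  have hdec := decay_eq_mul (p := p) hkn
  set T := remVar p A n (k + 1) with hTdef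
  set c := decay p n (k + 1) with hcdef
  have hT0 : 0 < T := by linarith
  have hs2 : 2 ≤ √T := Real.le_sqrt_of_sq_le (by linarith)
  have hs0 : 0 < √T := by linarith
  have hd0 : 0 ≤ d := by rw [hd]; positivity
  have hd1 : d ≤ 1 / 2 := by
    rw [hd, div_le_div_iff₀ hs0 two_pos]; linarith
  have hdT : d ^ 2 * T = c ^ 2 := by
    rw [hd, div_pow, Real.sq_sqrt hT0.le]; field_simp
  set e := sigmaOne p ^ 2 * (1 - p) ^ 2 / k with he
  have hq2 : (1 - p) ^ 2 ≤ 1 := pow_le_one₀ (by linarith) (by linarith)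
  have hσ2 := sigmaOne_sq_le hp0 hp1
  have he0 : 0 ≤ e := by positivity
  have hnum : sigmaOne p ^ 2 * (1 - p) ^ 2 ≤ sigmaOne p ^ 2 :=
    mul_le_of_le_one_right (sq_nonneg _) hq2
  have he1 : e ≤ stepVar p := by
    rw [← sigmaOne_sq hp0 hp1, he]
    calc sigmaOne p ^ 2 * (1 - p) ^ 2 / k ≤ sigmaOne p ^ 2 * (1 - p) ^ 2 :=
          div_le_self (by positivity) hk'
      _ ≤ sigmaOne p ^ 2 * 1 := by linarith
      _ ≤ sigmaOne p ^ 2 * (3 - 2 * p) := by gcongr; linarith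
  have he2 : e ≤ 2 * (1 / k) := by
    rw [he, mul_one_div]
    gcongr
    linarith
  rw [h.step k hk (testFn p A x n (k + 1))]
  have i1 := h.integrable_comp hk fun m => p * testFn p A x n (k + 1) (m + 1)
    + (1 - p) * (m / k) * testFn p A x n (k + 1) (m - 1)
    + (1 - p) * (1 - m / k) * testFn p A x n (k + 1) m
  have i2 := h.integrable_comp hk (testFn p A x n k)
  have i3 := h.integrable_comp hk fun m => stepThird p * d ^ 3 / 6 * npdf₂ (z m)
  have i4 := h.integrable_comp hk fun m =>
    40 * d ^ 2 * ((|m / k - nuLim p| + 1 / k) * bump (z m))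
  have i5 := h.integrable_comp hk fun m => 8000 * d ^ 4 * bump (z m)
  have hpt : ∀ ω, |p * testFn p A x n (k + 1) (S k ω + 1)
      + (1 - p) * ((S k ω : ℝ) / k) * testFn p A x n (k + 1) (S k ω - 1)
      + (1 - p) * (1 - (S k ω : ℝ) / k) * testFn p A x n (k + 1) (S k ω)
      - testFn p A x n k (S k ω) + stepThird p * d ^ 3 / 6 * npdf₂ (z (S k ω))|
      ≤ 40 * d ^ 2 * ((|(S k ω : ℝ) / k - nuLim p| + 1 / k) * bump (z (S k ω)))
        + 8000 * d ^ 4 * bump (z (S k ω)) := by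
    intro ω
    obtain ⟨hw0, hw1⟩ := h.ratio_mem hk ω
    obtain ⟨y, hy⟩ : ∃ y, y = (S k ω : ℝ) / k - nuLim p := ⟨_, rfl⟩
    have hw : (S k ω : ℝ) / k = nuLim p + y := by rw [hy]; ring
    have hS : (S k ω : ℝ) = k * (nuLim p + y) := by rw [← hw]; field_simp
    rw [hw] at hw0 hw1
    have key := abs_ncdf_step_le hp0 hp1 (z := z (S k ω)) hw0 hw1 hd0 hd1 he0 he1 he2
    -- The relation c_k = (1 - (1-p)/k) c_{k+1} turns an increment δ into its centred version, with
    -- conditional mean v - (1-p) y removed.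
    have inc : ∀ δ m : ℝ, m = S k ω + δ → testFn p A x n (k + 1) m
        = ncdf (z (S k ω) - d * (δ - nuLim p + (1 - p) * y)) := by
      intro δ m hm
      rw [testFn, hz, hm, hd, ← hcdef, ← hTdef, hdec, hS]
      congr 1
      push_cast
      field_simp
      ring
    have f1 := inc 1 (S k ω + 1) rfl
    have f2 := inc (-1) (S k ω - 1) (by ring)
    have f3 := inc 0 (S k ω) (by ring)
    rw [zero_sub] at f3
    -- By `remVar_step`, T_k = T_{k+1} (1 + d² (stepVar - e)), so at time k the same point z is seen
    -- after heat flow for relative time d² (stepVar - e).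
    have f4 : testFn p A x n k (S k ω)
        = ncdf (z (S k ω) / √(1 + d ^ 2 * (stepVar p - e))) := by
      rw [testFn, hz, div_div, ← Real.sqrt_mul hT0.le, hstep]
      congr 3
      rw [mul_add, mul_one, ← mul_assoc, mul_comm T, hdT]
    rw [f1, f2, f3, f4, ← hy, hw]
    exact key
  have hsum : (∫ ω, (p * testFn p A x n (k + 1) (S k ω + 1)
      + (1 - p) * ((S k ω : ℝ) / k) * testFn p A x n (k + 1) (S k ω - 1)
      + (1 - p) * (1 - (S k ω : ℝ) / k) * testFn p A x n (k + 1) (S k ω)) ∂μ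
      - ∫ ω, testFn p A x n k (S k ω) ∂μ)
      + stepThird p * d ^ 3 / 6 * ∫ ω, npdf₂ (z (S k ω)) ∂μ
      = ∫ ω, (p * testFn p A x n (k + 1) (S k ω + 1)
      + (1 - p) * ((S k ω : ℝ) / k) * testFn p A x n (k + 1) (S k ω - 1)
      + (1 - p) * (1 - (S k ω : ℝ) / k) * testFn p A x n (k + 1) (S k ω)
      - testFn p A x n k (S k ω) + stepThird p * d ^ 3 / 6 * npdf₂ (z (S k ω))) ∂μ := by
    have e1 := integral_add (i1.sub i2) i3
    simp only [Pi.sub_apply] at e1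
    rw [e1, integral_sub i1 i2, integral_const_mul]
  have hb : |(∫ ω, (p * testFn p A x n (k + 1) (S k ω + 1)
      + (1 - p) * ((S k ω : ℝ) / k) * testFn p A x n (k + 1) (S k ω - 1)
      + (1 - p) * (1 - (S k ω : ℝ) / k) * testFn p A x n (k + 1) (S k ω)) ∂μ
      - ∫ ω, testFn p A x n k (S k ω) ∂μ)
      + stepThird p * d ^ 3 / 6 * ∫ ω, npdf₂ (z (S k ω)) ∂μ|
      ≤ 40 * d ^ 2 * ∫ ω, (|(S k ω : ℝ) / k - nuLim p| + 1 / k) * bump (z (S k ω)) ∂μ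
        + 8000 * d ^ 4 * ∫ ω, bump (z (S k ω)) ∂μ := by
    rw [hsum, ← integral_const_mul, ← integral_const_mul, ← integral_add i4 i5]
    exact (abs_integral_le_integral_abs).trans
      (integral_mono (((i1.sub i2).add i3).abs) (i4.add i5) hpt)
  have h3 : |stepThird p * d ^ 3 / 6 * ∫ ω, npdf₂ (z (S k ω)) ∂μ|
      ≤ d ^ 3 * |∫ ω, npdf₂ (z (S k ω)) ∂μ| := by
    rw [abs_mul]
    gcongr
    rw [abs_div, abs_mul, abs_of_nonneg (by positivity : 0 ≤ d ^ 3),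
      abs_of_pos (by norm_num : (0 : ℝ) < 6), div_le_iff₀ (by norm_num)]
    have := abs_stepThird_le hp0 hp1
    have : 0 ≤ d ^ 3 := by positivity
    nlinarith
  rw [abs_le] at hb h3 ⊢
  constructor <;> linarith [hb.1, hb.2, h3.1, h3.2]

end IsSingletonChain

/-! ### Sums of powers and bookkeeping of scales -/

section Sums

/-- `x ^ (-1/4)`. -/
noncomputable def invRoot (x : ℝ) : ℝ := 1 / √√x

theorem invRoot_pos {x : ℝ} (hx : 0 < x) : 0 < invRoot x := by
  unfold invRoot; have := Real.sqrt_pos.2 (Real.sqrt_pos.2 hx); positivity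

theorem invRoot_sq {x : ℝ} : invRoot x ^ 2 = 1 / √x := by
  rw [invRoot, div_pow, one_pow, Real.sq_sqrt (Real.sqrt_nonneg x)]

theorem invRoot_pow_four {x : ℝ} (hx : 0 ≤ x) : invRoot x ^ 4 = 1 / x := by
  rw [show invRoot x ^ 4 = (invRoot x ^ 2) ^ 2 by ring, invRoot_sq, div_pow, one_pow,
    Real.sq_sqrt hx]

theorem invRoot_anti {x y : ℝ} (hx : 0 < x) (hxy : x ≤ y) : invRoot y ≤ invRoot x := by
  unfold invRoot
  have := Real.sqrt_pos.2 (Real.sqrt_pos.2 hx)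
  gcongr

theorem sum_one_div_sqrt_le (n : ℕ) : ∑ j ∈ Finset.range n, 1 / √((j : ℝ) + 1) ≤ 2 * √n := by
  induction n with
  | zero => simp
  | succ n ih =>
    rw [Finset.sum_range_succ]
    push_cast
    set a := √(n : ℝ)
    set b := √((n : ℝ) + 1)
    have ha : a ^ 2 = n := Real.sq_sqrt (by positivity)
    have hb : b ^ 2 = n + 1 := Real.sq_sqrt (by positivity)
    have hb0 : 0 < b := Real.sqrt_pos.2 (by positivity)
    have : 1 / b ≤ 2 * (b - a) := by
      rw [div_le_iff₀ hb0]
      nlinarith [sq_nonneg (b - a)]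
    linarith

theorem sum_invRoot_cube_le (n : ℕ) :
    ∑ j ∈ Finset.range n, invRoot ((j : ℝ) + 1) ^ 3 ≤ 4 * √√n := by
  induction n with
  | zero => simp
  | succ n ih =>
    rw [Finset.sum_range_succ]
    push_cast
    have h4 : ∀ x : ℝ, 0 ≤ x → √√x ^ 4 = x := fun x hx => by
      rw [show √√x ^ 4 = (√√x ^ 2) ^ 2 by ring, Real.sq_sqrt (Real.sqrt_nonneg x), Real.sq_sqrt hx]
    have ha := h4 n (by positivity)
    have hb := h4 (n + 1) (by positivity)
    have hab : √√(n : ℝ) ≤ √√((n : ℝ) + 1) :=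
      Real.sqrt_le_sqrt (Real.sqrt_le_sqrt (by linarith))
    rw [invRoot]
    set a := √√(n : ℝ)
    set b := √√((n : ℝ) + 1)
    have ha0 : 0 ≤ a := Real.sqrt_nonneg _
    have hb0 : 0 < b := Real.sqrt_pos.2 (Real.sqrt_pos.2 (by positivity))
    have : (1 / b) ^ 3 ≤ 4 * (b - a) := by
      rw [div_pow, one_pow, div_le_iff₀ (by positivity)]
      have e : b ^ 4 - a ^ 4 = (b - a) * (b ^ 3 + b ^ 2 * a + b * a ^ 2 + a ^ 3) := by ring
      have h1 : b ^ 3 + b ^ 2 * a + b * a ^ 2 + a ^ 3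
          ≤ b ^ 3 + b ^ 2 * b + b * b ^ 2 + b ^ 3 := by gcongr
      have h2 : (b - a) * (b ^ 3 + b ^ 2 * a + b * a ^ 2 + a ^ 3) ≤ (b - a) * (4 * b ^ 3) :=
        mul_le_mul_of_nonneg_left (by linarith) (by linarith)
      linarith
    linarith

/-- The terms (A+j)^{-3/2} are compared with differences of (A+j)^{-1/2}. The decay in A is what
makes the induction contract. -/
theorem sum_invRoot_pow_six_le {A : ℝ} (hA : 1 ≤ A) (n : ℕ) :
    ∑ j ∈ Finset.range n, invRoot (A + j) ^ 6 ≤ 6 * invRoot A ^ 2 := by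
  suffices h : ∑ j ∈ Finset.range n, invRoot (A + j) ^ 6 ≤ 6 * (1 / √A - 1 / √(A + n)) by
    have : 0 ≤ 1 / √(A + n) := by positivity
    rw [invRoot_sq]
    linarith
  induction n with
  | zero => simp
  | succ n ih =>
    rw [Finset.sum_range_succ]
    push_cast
    rw [show invRoot (A + n) ^ 6 = (invRoot (A + n) ^ 2) ^ 3 by ring, invRoot_sq]
    have hn : (0 : ℝ) ≤ n := by positivity
    rw [← add_assoc]
    set u := A + (n : ℝ)
    have hu : 1 ≤ u := by linarith
    set a := √u
    set b := √(u + 1)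
    have ha : a ^ 2 = u := Real.sq_sqrt (by positivity)
    have hb : b ^ 2 = u + 1 := Real.sq_sqrt (by positivity)
    have ha0 : 0 < a := Real.sqrt_pos.2 (by positivity)
    have hab : a ≤ b := Real.sqrt_le_sqrt (by linarith)
    have hb0 : 0 < b := by linarith
    have hb2 : b ≤ 3 / 2 * a := by
      apply le_of_sq_le_sq _ (by positivity)
      nlinarith
    have : (1 / a) ^ 3 ≤ 6 * (1 / a - 1 / b) := by
      rw [div_sub_div _ _ ha0.ne' hb0.ne', div_pow, one_pow, mul_div_assoc',
        div_le_div_iff₀ (by positivity) (by positivity)]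
      have e : (b - a) * (b + a) = 1 := by nlinarith
      have h1 : a * b * (b + a) ≤ 6 * a ^ 3 := by
        calc a * b * (b + a) ≤ a * (3 / 2 * a) * (3 / 2 * a + a) := by gcongr
          _ = 15 / 4 * a ^ 3 := by ring
          _ ≤ 6 * a ^ 3 := by gcongr; norm_num
      have h2 : 0 < b + a := by positivity
      refine le_of_mul_le_mul_right ?_ h2
      calc 1 * (a * b) * (b + a) = a * b * (b + a) := by ring
        _ ≤ 6 * a ^ 3 := h1
        _ = 6 * a ^ 3 * ((b - a) * (b + a)) := by rw [e, mul_one]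
        _ = _ := by ring
    linarith

end Sums

/-- A scale constant that dominates the ones that come from `p` and `σ₁`. -/
noncomputable def scaleConst (p : ℝ) : ℝ := 4 / (p * sigmaOne p)

section ScaleConst

variable {p : ℝ}

theorem sigmaOne_le (hp0 : 0 < p) (hp1 : p < 1) : sigmaOne p ≤ 2 := by
  have := sigmaOne_sq_le hp0 hp1
  nlinarith

theorem one_div_sigmaOne_le (hp0 : 0 < p) (hp1 : p < 1) : 1 / sigmaOne p ≤ scaleConst p := by
  have h := sigmaOne_pos hp0 hp1
  unfold scaleConst
  rw [div_le_div_iff₀ h (by positivity)]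
  nlinarith

theorem two_le_scaleConst (hp0 : 0 < p) (hp1 : p < 1) : 2 ≤ scaleConst p := by
  have h := sigmaOne_pos hp0 hp1
  have h2 := sigmaOne_le hp0 hp1
  unfold scaleConst
  rw [le_div_iff₀ (by positivity)]
  nlinarith

end ScaleConst

/-- The arithmetic of the bound for one late step; `i` and `ν` stand for the fourth roots of the
inverses of the remaining variance and of the time. -/
theorem late_step_arith {d i ν C L I J Q : ℝ} (hd0 : 0 ≤ d) (hdi : d ≤ i ^ 2) (hi0 : 0 < i)
    (hi1 : i ≤ 1) (hν : 0 < ν) (hC : 0 ≤ C) (hL : 1 ≤ L)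
    (hI0 : 0 ≤ I) (hI : I ≤ 600 * (2 * C * ν ^ 2 + (L * ν ^ 2 / i ^ 2) ^ 2))
    (hJ0 : 0 ≤ J) (hJ : J ≤ 4 * (2 * C * ν ^ 2 + L * ν ^ 2 / i ^ 2))
    (hQ0 : 0 ≤ Q) (hQ : Q ≤ 1 / (ν * i) / 2 * (20 * ν ^ 4) + ν * i / 2 * J) :
    d ^ 3 * I + 40 * d ^ 2 * Q + 8000 * d ^ 4 * J
      ≤ 100000 * ((C + L) * (ν ^ 2 * i ^ 6) + L ^ 2 * (ν ^ 4 * i ^ 2) + L * (ν ^ 3 * i ^ 3)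
        + C * (ν ^ 3 * i ^ 5)) := by
  have t1 : d ^ 3 * I ≤ 1200 * C * (ν ^ 2 * i ^ 6) + 600 * L ^ 2 * (ν ^ 4 * i ^ 2) := by
    calc d ^ 3 * I ≤ (i ^ 2) ^ 3 * (600 * (2 * C * ν ^ 2 + (L * ν ^ 2 / i ^ 2) ^ 2)) := by gcongr
      _ = _ := by field_simp; ring
  have t2 : 40 * d ^ 2 * Q
      ≤ 400 * (ν ^ 3 * i ^ 3) + 160 * C * (ν ^ 3 * i ^ 5) + 80 * L * (ν ^ 3 * i ^ 3) := by
    calc 40 * d ^ 2 * Q ≤ 40 * (i ^ 2) ^ 2 * (1 / (ν * i) / 2 * (20 * ν ^ 4)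
          + ν * i / 2 * (4 * (2 * C * ν ^ 2 + L * ν ^ 2 / i ^ 2))) := by
            gcongr
            exact hQ.trans (by gcongr)
      _ = _ := by field_simp; ring
  have t3 : 8000 * d ^ 4 * J ≤ 64000 * C * (ν ^ 2 * i ^ 6) + 32000 * L * (ν ^ 2 * i ^ 6) := by
    calc 8000 * d ^ 4 * J
        ≤ 8000 * (i ^ 2) ^ 4 * (4 * (2 * C * ν ^ 2 + L * ν ^ 2 / i ^ 2)) := by gcongr
      _ = 64000 * C * (ν ^ 2 * i ^ 6) * i ^ 2 + 32000 * L * (ν ^ 2 * i ^ 6) := by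
          field_simp; ring
      _ ≤ 64000 * C * (ν ^ 2 * i ^ 6) * 1 + 32000 * L * (ν ^ 2 * i ^ 6) := by
          gcongr; exact pow_le_one₀ hi0.le hi1
      _ = _ := by ring
  have p1 : 0 ≤ C * (ν ^ 2 * i ^ 6) := by positivity
  have p2 : 0 ≤ L * (ν ^ 2 * i ^ 6) := by positivity
  have p3 : 0 ≤ L ^ 2 * (ν ^ 4 * i ^ 2) := by positivity
  have p4 : ν ^ 3 * i ^ 3 ≤ L * (ν ^ 3 * i ^ 3) := le_mul_of_one_le_left (by positivity) hL
  have p5 : 0 ≤ C * (ν ^ 3 * i ^ 5) := by positivity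
  have p6 : 0 ≤ ν ^ 3 * i ^ 3 := by positivity
  linarith

theorem late_step_rescale {i ν η C L : ℝ} (hi0 : 0 < i) (hν0 : 0 < ν) (hη0 : 0 < η) (hC : 0 ≤ C)
    (hL1 : 1 ≤ L) (hiη : i ≤ L * η) :
    100000 * ((C + L) * (ν ^ 2 * i ^ 6) + L ^ 2 * (ν ^ 4 * i ^ 2) + L * (ν ^ 3 * i ^ 3)
        + C * (ν ^ 3 * i ^ 5))
      ≤ 100000 * L ^ 8 * ((C + 1) * (ν ^ 2 * η ^ 6) + ν ^ 4 * η ^ 2 + ν ^ 3 * η ^ 3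
        + C * (ν ^ 3 * η ^ 5)) := by
  have hL0 : 0 < L := by linarith
  have hLp : ∀ m, m ≤ 8 → L ^ m ≤ L ^ 8 := fun m hm => pow_le_pow_right₀ hL1 hm
  have hCL : C + L ≤ L * (C + 1) := by nlinarith
  have b1 : (C + L) * (ν ^ 2 * i ^ 6) ≤ L ^ 8 * ((C + 1) * (ν ^ 2 * η ^ 6)) := by
    calc (C + L) * (ν ^ 2 * i ^ 6) ≤ (L * (C + 1)) * (ν ^ 2 * (L * η) ^ 6) := by gcongr
      _ = L ^ 7 * ((C + 1) * (ν ^ 2 * η ^ 6)) := by ring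
      _ ≤ _ := mul_le_mul_of_nonneg_right (hLp 7 (by norm_num)) (by positivity)
  have b2 : L ^ 2 * (ν ^ 4 * i ^ 2) ≤ L ^ 8 * (ν ^ 4 * η ^ 2) := by
    calc L ^ 2 * (ν ^ 4 * i ^ 2) ≤ L ^ 2 * (ν ^ 4 * (L * η) ^ 2) := by gcongr
      _ = L ^ 4 * (ν ^ 4 * η ^ 2) := by ring
      _ ≤ _ := mul_le_mul_of_nonneg_right (hLp 4 (by norm_num)) (by positivity)
  have b3 : L * (ν ^ 3 * i ^ 3) ≤ L ^ 8 * (ν ^ 3 * η ^ 3) := by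
    calc L * (ν ^ 3 * i ^ 3) ≤ L * (ν ^ 3 * (L * η) ^ 3) := by gcongr
      _ = L ^ 4 * (ν ^ 3 * η ^ 3) := by ring
      _ ≤ _ := mul_le_mul_of_nonneg_right (hLp 4 (by norm_num)) (by positivity)
  have b4 : C * (ν ^ 3 * i ^ 5) ≤ L ^ 8 * (C * (ν ^ 3 * η ^ 5)) := by
    calc C * (ν ^ 3 * i ^ 5) ≤ C * (ν ^ 3 * (L * η) ^ 5) := by gcongr
      _ = L ^ 5 * (C * (ν ^ 3 * η ^ 5)) := by ring
      _ ≤ _ := mul_le_mul_of_nonneg_right (hLp 5 (by norm_num)) (by positivity)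
  linarith

theorem early_step_arith {d i ν L I J Q s : ℝ} (hd0 : 0 ≤ d) (hdi : d ≤ i ^ 2) (hi0 : 0 < i)
    (hi1 : i ≤ 1) (hL : 1 ≤ L) (hs : 0 < s) (hi4 : i ^ 4 ≤ 2 * L ^ 2 * ν ^ 4)
    (his : i ^ 2 ≤ 2 * L / s) (hI0 : 0 ≤ I) (hI : I ≤ 8) (hJ0 : 0 ≤ J) (hJ : J ≤ 1)
    (hQ0 : 0 ≤ Q) (hQ : Q ≤ 6 / s) :
    d ^ 3 * I + 40 * d ^ 2 * Q + 8000 * d ^ 4 * J ≤ 100000 * L ^ 3 * (ν ^ 4 / s) := by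
  have t1 : d ^ 3 * I ≤ i ^ 4 * (16 * (L / s)) := by
    calc d ^ 3 * I ≤ (i ^ 2) ^ 3 * 8 := by gcongr
      _ = i ^ 4 * (i ^ 2 * 8) := by ring
      _ ≤ i ^ 4 * (2 * L / s * 8) := by gcongr
      _ = _ := by ring
  have t2 : 40 * d ^ 2 * Q ≤ i ^ 4 * (240 * (L / s)) := by
    calc 40 * d ^ 2 * Q ≤ 40 * (i ^ 2) ^ 2 * (6 / s) := by gcongr
      _ = i ^ 4 * (240 * (1 / s)) := by ring
      _ ≤ _ := by gcongr
  have t3 : 8000 * d ^ 4 * J ≤ i ^ 4 * (16000 * (L / s)) := by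
    calc 8000 * d ^ 4 * J ≤ 8000 * (i ^ 2) ^ 4 * 1 := by gcongr
      _ = i ^ 4 * (8000 * (i ^ 2 * i ^ 2)) := by ring
      _ ≤ i ^ 4 * (8000 * (2 * L / s * 1)) := by
          gcongr; exact pow_le_one₀ hi0.le hi1
      _ = _ := by ring
  have hLs : 0 ≤ L / s := by positivity
  calc _ ≤ i ^ 4 * (16256 * (L / s)) := by linarith
    _ ≤ 2 * L ^ 2 * ν ^ 4 * (16256 * (L / s)) := by gcongr
    _ = 32512 * (L ^ 3 * (ν ^ 4 / s)) := by ring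
    _ ≤ 100000 * (L ^ 3 * (ν ^ 4 / s)) := by
        gcongr
        norm_num
    _ = _ := by ring

/-! ### Early and late replacement steps -/

namespace IsSingletonChain

variable {Ω : Type*} [MeasurableSpace Ω] {μ : Measure Ω} {p : ℝ} {S : ℕ → Ω → ℕ}

/-- The law of the normalized variable `(ν₁(k) - k p / (2 - p)) / (σ₁ √k)`. -/
noncomputable def normLaw (μ : Measure Ω) (p : ℝ) (S : ℕ → Ω → ℕ) (k : ℕ) : Measure ℝ :=
  μ.map fun ω => ((S k ω : ℝ) - k * nuLim p) / (sigmaOne p * √k)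

theorem measurable_norm (h : IsSingletonChain μ p S) {k : ℕ} (hk : 1 ≤ k) :
    Measurable fun ω => ((S k ω : ℝ) - k * nuLim p) / (sigmaOne p * √k) :=
  h.measurable_comp hk fun m => (m - k * nuLim p) / (sigmaOne p * √k)

theorem isProbabilityMeasure_normLaw [IsProbabilityMeasure μ] (h : IsSingletonChain μ p S) {k : ℕ}
    (hk : 1 ≤ k) : IsProbabilityMeasure (normLaw μ p S k) :=
  Measure.isProbabilityMeasure_map (h.measurable_norm hk).aemeasurable

theorem integral_comp_eq_normLaw (h : IsSingletonChain μ p S) (hp0 : 0 < p) (hp1 : p < 1) {k : ℕ}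
    (hk : 1 ≤ k) {F : ℝ → ℝ} (hF : Continuous F) (x c s : ℝ) :
    ∫ ω, F ((x - c * ((S k ω : ℝ) - k * nuLim p)) / s) ∂μ
      = ∫ y, F ((x - c * (sigmaOne p * √k) * y) / s) ∂(normLaw μ p S k) := by
  have hσ := sigmaOne_pos hp0 hp1
  have hk' : 0 < √(k : ℝ) := Real.sqrt_pos.2 (by exact_mod_cast hk)
  rw [normLaw, integral_map (h.measurable_norm hk).aemeasurable
    (by fun_prop : Continuous fun y =>
      F ((x - c * (sigmaOne p * √k) * y) / s)).aestronglyMeasurable]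
  refine integral_congr_ae (Eventually.of_forall fun ω => ?_)
  simp only
  congr 3
  field_simp

/-- Separates the fluctuation of S_k / k, known in mean square, from the localization of b: u b ≤ λ
u²/2 + b²/(2λ), and b² ≤ b. The parameter λ is chosen differently for early and late times. -/
theorem integral_mul_le_amgm [IsProbabilityMeasure μ] (h : IsSingletonChain μ p S) (hp0 : 0 < p)
    (hp1 : p < 1) {k : ℕ} (hk : 1 ≤ k) {b : ℝ → ℝ} (hb0 : ∀ m, 0 ≤ b m) (hb1 : ∀ m, b m ≤ 1)
    {lam : ℝ} (hl : 0 < lam) :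
    ∫ ω, (|(S k ω : ℝ) / k - nuLim p| + 1 / k) * b (S k ω) ∂μ
      ≤ lam / 2 * (10 / k) + 1 / lam / 2 * ∫ ω, b (S k ω) ∂μ := by
  calc ∫ ω, (|(S k ω : ℝ) / k - nuLim p| + 1 / k) * b (S k ω) ∂μ
      ≤ ∫ ω, (lam / 2 * (|(S k ω : ℝ) / k - nuLim p| + 1 / k) ^ 2
          + 1 / lam / 2 * b (S k ω)) ∂μ := by
        refine integral_mono (h.integrable_comp hk fun m => (|m / k - nuLim p| + 1 / k) * b m)
          (h.integrable_comp hk fun m =>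
            lam / 2 * (|m / k - nuLim p| + 1 / k) ^ 2 + 1 / lam / 2 * b m) fun ω => ?_
        simp only
        set u := |(S k ω : ℝ) / k - nuLim p| + 1 / k
        set w := b (S k ω)
        have hw0 : 0 ≤ w := hb0 _
        have hw1 : w ≤ 1 := hb1 _
        have hww : w ^ 2 ≤ w := by nlinarith
        have e : lam / 2 * u ^ 2 + 1 / lam / 2 * w ^ 2 - u * w = (lam * u - w) ^ 2 / (2 * lam) := by
          field_simp; ring
        have h1 : 0 ≤ (lam * u - w) ^ 2 / (2 * lam) := by positivity
        have h2 : 1 / lam / 2 * w ^ 2 ≤ 1 / lam / 2 * w := by gcongr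
        linarith
    _ = lam / 2 * ∫ ω, (|(S k ω : ℝ) / k - nuLim p| + 1 / k) ^ 2 ∂μ
        + 1 / lam / 2 * ∫ ω, b (S k ω) ∂μ := by
        rw [integral_add
          (h.integrable_comp hk fun m => lam / 2 * (|m / k - nuLim p| + 1 / k) ^ 2)
          (h.integrable_comp hk fun m => 1 / lam / 2 * b m), integral_const_mul, integral_const_mul]
    _ ≤ _ := by
        have := h.integral_ratio_sq_le hp0 hp1 hk
        gcongr

/-- More than half of the time remains, so T is at least of order n and d² = O(1/n). Each step costs
O(n⁻¹ k^{-1/2}), which sums to O(n^{-1/2}) without any induction hypothesis. -/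
theorem testFn_step_early [IsProbabilityMeasure μ] (h : IsSingletonChain μ p S) (hp0 : 0 < p)
    (hp1 : p < 1) {A x : ℝ} (hA1 : 1 ≤ A) (hA : 4 ≤ sigmaOne p ^ 2 * A) {n k : ℕ} (hk : 1 ≤ k)
    (hkn : 2 * k < n) :
    |∫ ω, testFn p (sigmaOne p ^ 2 * A) x n (k + 1) (S (k + 1) ω) ∂μ
        - ∫ ω, testFn p (sigmaOne p ^ 2 * A) x n k (S k ω) ∂μ|
      ≤ 100000 * scaleConst p ^ 3 * (invRoot n ^ 4 / √k) := by
  have hkn1 : k < n := by omega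
  have hk' : (1 : ℝ) ≤ k := by exact_mod_cast hk
  have hkn' : 2 * (k : ℝ) < n := by exact_mod_cast hkn
  have hs0 : 0 < √(k : ℝ) := Real.sqrt_pos.2 (by linarith)
  have hσ := sigmaOne_pos hp0 hp1
  have hL2 := two_le_scaleConst hp0 hp1
  have hLσ := one_div_sigmaOne_le hp0 hp1
  refine (h.abs_integral_testFn_step_le hp0 hp1 hA hk hkn1 rfl rfl).trans ?_
  set T := remVar p (sigmaOne p ^ 2 * A) n (k + 1) with hT
  set L := scaleConst p
  have hTge := le_remVar (A := sigmaOne p ^ 2 * A) hp0 hp1 (n := n) (show 1 ≤ k + 1 by omega)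
  rw [← hT] at hTge
  push_cast at hTge
  have hTn : sigmaOne p ^ 2 * (n / 2) ≤ T := by nlinarith [sq_nonneg (sigmaOne p)]
  have hT4 : 4 ≤ T := by nlinarith [sq_nonneg (sigmaOne p)]
  have hT0 : 0 < T := by linarith
  have hc0 := decay_nonneg hp0 hp1 (n := n) (show 1 ≤ k + 1 by omega)
  have hc1 := decay_le_one hp0 hp1 (n := n) (show 1 ≤ k + 1 by omega)
  have hn0 : (0 : ℝ) < n := by linarith
  have hi4 : invRoot T ^ 4 ≤ 2 * L ^ 2 * invRoot n ^ 4 := by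
    rw [invRoot_pow_four hT0.le, invRoot_pow_four hn0.le]
    calc 1 / T ≤ 1 / (sigmaOne p ^ 2 * (n / 2)) := by gcongr
      _ = 2 * (1 / sigmaOne p) ^ 2 * (1 / n) := by field_simp
      _ ≤ _ := by gcongr
  refine early_step_arith (i := invRoot T) (by positivity) ?_ (invRoot_pos hT0) ?_
    (by linarith) hs0 hi4 ?_ (abs_nonneg _) ?_ (integral_nonneg fun ω => (bump_pos _).le) ?_
    (integral_nonneg fun ω => mul_nonneg (by positivity) (bump_pos _).le) ?_
  · rw [invRoot_sq]; gcongr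
  · rw [invRoot, div_le_one (Real.sqrt_pos.2 (Real.sqrt_pos.2 hT0))]
    exact Real.le_sqrt_of_sq_le (Real.le_sqrt_of_sq_le (by linarith))
  · apply le_of_sq_le_sq _ (by positivity)
    rw [show (invRoot T ^ 2) ^ 2 = invRoot T ^ 4 by ring]
    refine hi4.trans ?_
    rw [invRoot_pow_four hn0.le, div_pow, Real.sq_sqrt (by linarith), mul_one_div, mul_pow]
    have hk0 : (0 : ℝ) < k := by linarith
    gcongr
    norm_num
  · have := norm_integral_le_of_norm_le_const (μ := μ) (C := 8)
      (f := fun ω => npdf₂ ((x - decay p n k * ((S k ω : ℝ) - k * nuLim p)) / √T))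
      (Eventually.of_forall fun ω => (abs_npdf₂_le _).trans (by
        have := bump_le_one ((x - decay p n k * ((S k ω : ℝ) - k * nuLim p)) / √T)
        linarith))
    simpa using this
  · have := norm_integral_le_of_norm_le_const (μ := μ) (C := 1)
      (f := fun ω => bump ((x - decay p n k * ((S k ω : ℝ) - k * nuLim p)) / √T))
      (Eventually.of_forall fun ω => by
        rw [Real.norm_eq_abs, abs_of_pos (bump_pos _)]; exact bump_le_one _)
    simp only [probReal_univ, mul_one] at this
    exact (le_abs_self _).trans this
  -- With b bounded by 1 only, λ = √k balances the two terms.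
  · refine (h.integral_mul_le_amgm hp0 hp1 hk
      (b := fun m => bump ((x - decay p n k * (m - k * nuLim p)) / √T))
      (fun m => (bump_pos _).le) (fun m => bump_le_one _) hs0).trans ?_
    have hJ : ∫ ω, bump ((x - decay p n k * ((S k ω : ℝ) - k * nuLim p)) / √T) ∂μ ≤ 1 := by
      have := norm_integral_le_of_norm_le_const (μ := μ) (C := 1)
        (f := fun ω => bump ((x - decay p n k * ((S k ω : ℝ) - k * nuLim p)) / √T))
        (Eventually.of_forall fun ω => by
          rw [Real.norm_eq_abs, abs_of_pos (bump_pos _)]; exact bump_le_one _)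
      simp only [probReal_univ, mul_one] at this
      exact (le_abs_self _).trans this
    have e : √(k : ℝ) / 2 * (10 / k) = 5 / √k := by
      have := Real.sq_sqrt (show (0 : ℝ) ≤ k by linarith)
      rw [← this, Real.sqrt_sq hs0.le]
      field_simp
      norm_num
    rw [e]
    calc 5 / √(k : ℝ) + 1 / √k / 2 * _ ≤ 5 / √(k : ℝ) + 1 / √k / 2 * 1 := by gcongr
      _ ≤ 5 / √(k : ℝ) + 1 / √k := by
          have : 0 ≤ 1 / √(k : ℝ) := by positivity
          linarith
      _ = 6 / √k := by ring

/-- Here k is comparable to n, so c_k ≥ p/2 and c_k (S_k - k v) has spread of order √n against a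
kernel of width √T. The hypothesis at time k then bounds the means of b and φ''. All scales are
written through fourth roots because the optimal λ below is (n T)^{1/4}. -/
theorem testFn_step_late [IsProbabilityMeasure μ] (h : IsSingletonChain μ p S) (hp0 : 0 < p)
    (hp1 : p < 1) {A x C : ℝ} (hA1 : 1 ≤ A) (hA : 4 ≤ sigmaOne p ^ 2 * A) (hC : 0 ≤ C) {n k : ℕ}
    (hk : 1 ≤ k) (hkn1 : k < n) (hkn : n ≤ 2 * k)
    (hind : ∀ t, |cdf (normLaw μ p S k) t - ncdf t| ≤ C / √k) :
    |∫ ω, testFn p (sigmaOne p ^ 2 * A) x n (k + 1) (S (k + 1) ω) ∂μ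
        - ∫ ω, testFn p (sigmaOne p ^ 2 * A) x n k (S k ω) ∂μ|
      ≤ 100000 * scaleConst p ^ 8 * ((C + 1) * (invRoot n ^ 2 * invRoot (A + (n - 1 - k : ℕ)) ^ 6)
        + invRoot n ^ 4 * invRoot (A + (n - 1 - k : ℕ)) ^ 2
        + invRoot n ^ 3 * invRoot (A + (n - 1 - k : ℕ)) ^ 3
        + C * (invRoot n ^ 3 * invRoot (A + (n - 1 - k : ℕ)) ^ 5)) := by
  have hk' : (1 : ℝ) ≤ k := by exact_mod_cast hk
  have hkn' : (n : ℝ) ≤ 2 * k := by exact_mod_cast hkn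
  have hkn1' : (k : ℝ) < n := by exact_mod_cast hkn1
  have hs0 : 0 < √(k : ℝ) := Real.sqrt_pos.2 (by linarith)
  have hn0 : (0 : ℝ) < n := by linarith
  have hsn0 : 0 < √(n : ℝ) := Real.sqrt_pos.2 hn0
  have hsk : √(n : ℝ) ≤ 2 * √k := by
    rw [Real.sqrt_le_left (by positivity), mul_pow, Real.sq_sqrt (by linarith)]
    linarith
  have hσ := sigmaOne_pos hp0 hp1
  have hL2 := two_le_scaleConst hp0 hp1
  have hLσ := one_div_sigmaOne_le hp0 hp1
  have hprob := h.isProbabilityMeasure_normLaw hk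
  refine (h.abs_integral_testFn_step_le hp0 hp1 hA hk hkn1 rfl rfl).trans ?_
  set T := remVar p (sigmaOne p ^ 2 * A) n (k + 1) with hT
  have hTge := le_remVar (A := sigmaOne p ^ 2 * A) hp0 hp1 (n := n) (show 1 ≤ k + 1 by omega)
  rw [← hT] at hTge
  push_cast at hTge
  obtain ⟨ℓ, hℓ⟩ : ∃ ℓ : ℝ, ℓ = A + (n - 1 - k : ℕ) := ⟨_, rfl⟩
  rw [← hℓ]
  have hℓ' : ℓ = A + (n - 1 - k) := by
    rw [hℓ, Nat.cast_sub (by omega), Nat.cast_sub (by omega)]; norm_num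
  have hℓ0 : 0 < ℓ := by rw [hℓ]; positivity
  have hTℓ : sigmaOne p ^ 2 * ℓ ≤ T := by rw [hℓ']; linarith
  have hn1 : (k : ℝ) + 1 ≤ n := by exact_mod_cast hkn1
  have hT4 : 4 ≤ T := by nlinarith [sq_nonneg (sigmaOne p)]
  have hT0 : 0 < T := by linarith
  have hsT : 0 < √T := Real.sqrt_pos.2 hT0
  have hc0 := decay_nonneg hp0 hp1 (n := n) (show 1 ≤ k + 1 by omega)
  have hc1 := decay_le_one hp0 hp1 (n := n) (show 1 ≤ k + 1 by omega)
  have hck : p / 2 ≤ decay p n k := by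
    refine le_trans ?_ (le_decay hp0 hp1 hk hkn1.le)
    rw [div_le_div_iff₀ two_pos hn0]
    nlinarith
  have hb : 0 < decay p n k * (sigmaOne p * √k) := by
    have : 0 < decay p n k := by linarith
    positivity
  have hbinv : √T / (decay p n k * (sigmaOne p * √k))
      ≤ scaleConst p * invRoot n ^ 2 / invRoot T ^ 2 := by
    rw [invRoot_sq, invRoot_sq, scaleConst]
    have hck0 : 0 ≤ decay p n k := by linarith
    have hsk' : √(n : ℝ) / 2 ≤ √k := by linarith
    calc √T / (decay p n k * (sigmaOne p * √k)) ≤ √T / (p / 2 * (sigmaOne p * (√n / 2))) := by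
          gcongr
      _ = _ := by field_simp; norm_num
  have hδ : C / √k ≤ 2 * C * invRoot n ^ 2 := by
    rw [invRoot_sq, mul_one_div, div_le_div_iff₀ hs0 hsn0]
    nlinarith
  have hi0 := invRoot_pos hT0
  have hν0 := invRoot_pos hn0
  have hη0 := invRoot_pos hℓ0
  have hiη : invRoot T ≤ scaleConst p * invRoot ℓ := by
    refine le_of_pow_le_pow_left₀ (n := 4) (by norm_num) (by positivity) ?_
    rw [mul_pow, invRoot_pow_four hT0.le, invRoot_pow_four hℓ0.le]
    calc 1 / T ≤ 1 / (sigmaOne p ^ 2 * ℓ) := by gcongr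
      _ = (1 / sigmaOne p) ^ 2 * (1 / ℓ) := by field_simp
      _ ≤ scaleConst p ^ 2 * (1 / ℓ) := by gcongr
      _ ≤ scaleConst p ^ 4 * (1 / ℓ) := by
          gcongr
          · linarith
          · norm_num
  have hbump := integral_bump_le (normLaw μ p S k) hind x hb hsT
  have hnp2 := abs_integral_npdf₂_le (normLaw μ p S k) hind x hb hsT
  rw [← h.integral_comp_eq_normLaw hp0 hp1 hk continuous_bump] at hbump
  rw [← h.integral_comp_eq_normLaw hp0 hp1 hk continuous_npdf₂] at hnp2
  have hfin := late_step_arith (d := decay p n (k + 1) / √T) (i := invRoot T) (ν := invRoot n)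
    (C := C) (L := scaleConst p)
    (I := |∫ ω, npdf₂ ((x - decay p n k * ((S k ω : ℝ) - k * nuLim p)) / √T) ∂μ|)
    (J := ∫ ω, bump ((x - decay p n k * ((S k ω : ℝ) - k * nuLim p)) / √T) ∂μ)
    (Q := ∫ ω, (|(S k ω : ℝ) / k - nuLim p| + 1 / k)
      * bump ((x - decay p n k * ((S k ω : ℝ) - k * nuLim p)) / √T) ∂μ)
    (by positivity) (by rw [invRoot_sq]; gcongr) hi0
    (by
      rw [invRoot, div_le_one (Real.sqrt_pos.2 hsT)]
      exact Real.le_sqrt_of_sq_le (Real.le_sqrt_of_sq_le (by linarith)))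
    hν0 hC (by linarith) (abs_nonneg _) (hnp2.trans (by gcongr))
    (integral_nonneg fun ω => (bump_pos _).le) (hbump.trans (by gcongr))
    (integral_nonneg fun ω => mul_nonneg (by positivity) (bump_pos _).le)
    (by
      refine (h.integral_mul_le_amgm hp0 hp1 hk
        (b := fun m => bump ((x - decay p n k * (m - k * nuLim p)) / √T))
        (fun m => (bump_pos _).le) (fun m => bump_le_one _)
        -- This balances λ / n against λ⁻¹ √(T/n), the main order of the mean of `bump`.
        (lam := 1 / (invRoot n * invRoot T)) (by positivity)).trans ?_
      rw [one_div_one_div]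
      gcongr
      rw [invRoot_pow_four hn0.le, mul_one_div, div_le_div_iff₀ (by linarith) hn0]
      linarith)
  refine hfin.trans ?_
  exact late_step_rescale hi0 hν0 hη0 hC (by linarith) hiη

end IsSingletonChain

/-! ### Endpoints of the interpolation, summation and induction -/

theorem abs_ncdf_div_sqrt_sub_le {z r : ℝ} (hr : 0 ≤ r) :
    |ncdf (z / √(1 + r)) - ncdf z| ≤ 204 * r := by
  rcases le_or_gt r 1 with h1 | h1
  · have h := abs_ncdf_div_sqrt_le (z := z) hr h1
    have h2 := abs_npdf₁_le z
    have h3 := bump_le_one z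
    have h4 := bump_pos z
    have h5 : |r / 2 * npdf₁ z| ≤ 4 * r := by
      rw [abs_mul, abs_of_nonneg (by positivity : 0 ≤ r / 2)]
      nlinarith
    have h6 : 200 * bump z * r ^ 2 ≤ 200 * r := by
      calc 200 * bump z * r ^ 2 ≤ 200 * 1 * (r * 1) := by
            rw [pow_two]; gcongr
        _ = 200 * r := by ring
    rw [abs_le] at h h5 ⊢
    constructor <;> linarith [h.1, h.2, h5.1, h5.2]
  · have a1 := ncdf_nonneg z
    have a2 := ncdf_le_one z
    have a3 := ncdf_nonneg (z / √(1 + r))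
    have a4 := ncdf_le_one (z / √(1 + r))
    rw [abs_le]
    constructor <;> linarith

/-- The starting point of the interpolation is close to `Φ`. -/
theorem abs_testFn_one_sub_le {p : ℝ} (hp0 : 0 < p) (hp1 : p < 1) {A : ℝ} (hA1 : 1 ≤ A) {n : ℕ}
    (hn : 1 ≤ n) (x : ℝ) :
    |testFn p (sigmaOne p ^ 2 * A) (sigmaOne p * √n * x) n 1 1 - ncdf x|
      ≤ (scaleConst p + 204 * A) / √n := by
  have hn' : (1 : ℝ) ≤ n := by exact_mod_cast hn
  have hσ := sigmaOne_pos hp0 hp1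
  have hsn : 1 ≤ √(n : ℝ) := Real.one_le_sqrt.2 hn'
  have hsn2 : √(n : ℝ) ^ 2 = n := Real.sq_sqrt (by linarith)
  have hc0 := decay_nonneg hp0 hp1 (n := n) le_rfl
  have hc1 := decay_le_one hp0 hp1 (n := n) le_rfl
  have hc2 : decay p n 1 ^ 2 ≤ 1 := pow_le_one₀ hc0 hc1
  have hv0 := nuLim_pos hp0 hp1
  have hv1 := nuLim_lt_one hp1
  set c := decay p n 1
  set r := (A - c ^ 2) / n with hr
  have hr0 : 0 ≤ r := div_nonneg (by linarith) (by linarith)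
  -- The initial variance exceeds the target σ₁² n only by the relative amount r = O(A/n); the shift
  -- c (1 - v) from S_1 = 1 costs O(n^{-1/2}).
  have hrem : remVar p (sigmaOne p ^ 2 * A) n 1 = (sigmaOne p * √n) ^ 2 * (1 + r) := by
    rw [remVar, mul_pow, hsn2, hr]
    field_simp
    push_cast
    ring
  have hsq : √(remVar p (sigmaOne p ^ 2 * A) n 1) = sigmaOne p * √n * √(1 + r) := by
    rw [hrem, Real.sqrt_mul (by positivity), Real.sqrt_sq (by positivity)]
  have h1r : 1 ≤ √(1 + r) := Real.one_le_sqrt.2 (by linarith)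
  have e : (sigmaOne p * √n * x - c * (1 - (1 : ℕ) * nuLim p)) / (sigmaOne p * √n * √(1 + r))
      = x / √(1 + r) - c * (1 - nuLim p) / (sigmaOne p * √n * √(1 + r)) := by
    push_cast
    field_simp
  rw [testFn, hsq, e]
  have t1 := abs_ncdf_sub_le (x / √(1 + r) - c * (1 - nuLim p) / (sigmaOne p * √n * √(1 + r)))
    (x / √(1 + r))
  have t2 := abs_ncdf_div_sqrt_sub_le (z := x) hr0
  have t3 : |x / √(1 + r) - c * (1 - nuLim p) / (sigmaOne p * √n * √(1 + r)) - x / √(1 + r)|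
      ≤ scaleConst p / √n := by
    rw [show ∀ a b : ℝ, a - b - a = -b by intros; ring, abs_neg,
      abs_of_nonneg (div_nonneg (mul_nonneg hc0 (by linarith)) (by positivity))]
    calc c * (1 - nuLim p) / (sigmaOne p * √n * √(1 + r)) ≤ 1 / (sigmaOne p * √n * 1) := by
          gcongr
          exact mul_le_one₀ hc1 (by linarith) (by linarith)
      _ = 1 / sigmaOne p / √n := by field_simp
      _ ≤ _ := by
          have := one_div_sigmaOne_le hp0 hp1
          gcongr
  have t4 : 204 * r ≤ 204 * A / √n := by
    rw [hr, mul_div_assoc]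
    have : (A - c ^ 2) / (n : ℝ) ≤ A / √n := by
      gcongr
      · nlinarith
      · nlinarith
    linarith
  rw [add_div]
  have := abs_sub_le (ncdf (x / √(1 + r) - c * (1 - nuLim p) / (sigmaOne p * √n * √(1 + r))))
    (ncdf (x / √(1 + r))) (ncdf x)
  linarith

namespace IsSingletonChain

variable {Ω : Type*} [MeasurableSpace Ω] {μ : Measure Ω} {p : ℝ} {S : ℕ → Ω → ℕ}

/-- One bound valid at early and late times, so that the telescoping sum need not be split. Two of
the six factors of fifth-power type, namely invRoot (A+j)² out of invRoot (A+j)⁵, are traded for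
invRoot A², so that this C term too decays in A. -/
theorem testFn_step [IsProbabilityMeasure μ] (h : IsSingletonChain μ p S) (hp0 : 0 < p)
    (hp1 : p < 1) {A x C : ℝ} (hA1 : 1 ≤ A) (hA : 4 ≤ sigmaOne p ^ 2 * A) (hC : 0 ≤ C) {n k : ℕ}
    (hk : 1 ≤ k) (hkn : k < n) (hind : ∀ t, |cdf (normLaw μ p S k) t - ncdf t| ≤ C / √k) :
    |∫ ω, testFn p (sigmaOne p ^ 2 * A) x n (k + 1) (S (k + 1) ω) ∂μ
        - ∫ ω, testFn p (sigmaOne p ^ 2 * A) x n k (S k ω) ∂μ|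
      ≤ 100000 * scaleConst p ^ 8 * (invRoot n ^ 4 * (1 / √k)
        + (C + 1) * invRoot n ^ 2 * invRoot (A + (n - 1 - k : ℕ)) ^ 6
        + invRoot n ^ 4 * (1 / √((n - 1 - k : ℕ) + 1))
        + (1 + C * invRoot A ^ 2) * invRoot n ^ 3 * invRoot ((n - 1 - k : ℕ) + 1) ^ 3) := by
  have hn0 : (0 : ℝ) < n := by exact_mod_cast (show 0 < n by omega)
  have hν := invRoot_pos hn0
  set j := n - 1 - k
  have hj : (0 : ℝ) ≤ j := by positivity
  have hη := invRoot_pos (show 0 < A + (j : ℝ) by linarith)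
  have hθ := invRoot_pos (show 0 < (j : ℝ) + 1 by linarith)
  have hα := invRoot_pos (show 0 < A by linarith)
  have hηθ := invRoot_anti (show 0 < (j : ℝ) + 1 by linarith)
    (show (j : ℝ) + 1 ≤ A + j by linarith)
  have hηα := invRoot_anti (show 0 < A by linarith) (show A ≤ A + j by linarith)
  have hL := two_le_scaleConst hp0 hp1
  rw [← invRoot_sq (x := (j : ℝ) + 1)]
  rcases lt_or_ge (2 * k) n with h2 | h2
  · refine (h.testFn_step_early hp0 hp1 hA1 hA hk h2).trans ?_
    have hL38 : scaleConst p ^ 3 ≤ scaleConst p ^ 8 :=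
      pow_le_pow_right₀ (by linarith) (by norm_num)
    rw [mul_one_div]
    have a1 : 0 ≤ (C + 1) * invRoot n ^ 2 * invRoot (A + j) ^ 6 := by positivity
    have a2 : 0 ≤ invRoot n ^ 4 * invRoot (j + 1) ^ 2 := by positivity
    have a3 : 0 ≤ (1 + C * invRoot A ^ 2) * invRoot n ^ 3 * invRoot (j + 1) ^ 3 := by positivity
    gcongr
    linarith
  · refine (h.testFn_step_late hp0 hp1 hA1 hA hC hk hkn h2 hind).trans ?_
    refine mul_le_mul_of_nonneg_left ?_ (by positivity)
    change (C + 1) * (invRoot n ^ 2 * invRoot (A + j) ^ 6) + invRoot n ^ 4 * invRoot (A + j) ^ 2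
      + invRoot n ^ 3 * invRoot (A + j) ^ 3 + C * (invRoot n ^ 3 * invRoot (A + j) ^ 5) ≤ _
    have a0 : 0 ≤ invRoot n ^ 4 * (1 / √(k : ℝ)) := by positivity
    have a1 : invRoot n ^ 4 * invRoot (A + j) ^ 2 ≤ invRoot n ^ 4 * invRoot (j + 1) ^ 2 := by
      gcongr
    have a2 : invRoot n ^ 3 * invRoot (A + j) ^ 3 ≤ invRoot n ^ 3 * invRoot (j + 1) ^ 3 := by
      gcongr
    have a3 : C * (invRoot n ^ 3 * invRoot (A + j) ^ 5)
        ≤ C * (invRoot n ^ 3 * (invRoot A ^ 2 * invRoot (j + 1) ^ 3)) := by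
      have : invRoot (A + j) ^ 5 ≤ invRoot A ^ 2 * invRoot (j + 1) ^ 3 := by
        calc invRoot (A + j) ^ 5 = invRoot (A + j) ^ 2 * invRoot (A + j) ^ 3 := by ring
          _ ≤ _ := by gcongr
      gcongr
    linarith

theorem abs_integral_testFn_sub_le [IsProbabilityMeasure μ] (h : IsSingletonChain μ p S)
    (hp0 : 0 < p) (hp1 : p < 1) {A C : ℝ} (hA1 : 1 ≤ A) (hA : 4 ≤ sigmaOne p ^ 2 * A)
    (hC : 0 ≤ C) {n : ℕ} (hn : 1 ≤ n)
    (hind : ∀ k, 1 ≤ k → k < n → ∀ t, |cdf (normLaw μ p S k) t - ncdf t| ≤ C / √k) (x : ℝ) :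
    |∫ ω, testFn p (sigmaOne p ^ 2 * A) x n n (S n ω) ∂μ
        - ∫ ω, testFn p (sigmaOne p ^ 2 * A) x n 1 (S 1 ω) ∂μ|
      ≤ 100000 * scaleConst p ^ 8 * (14 + 10 * C / √A) / √n := by
  obtain ⟨N, rfl⟩ : ∃ N, n = N + 1 := ⟨n - 1, by omega⟩
  set n := N + 1 with hnN
  have hn0 : (0 : ℝ) < n := by positivity
  set K := 100000 * scaleConst p ^ 8 with hK
  have hL := two_le_scaleConst hp0 hp1
  have hK0 : 0 ≤ K := by positivity
  set ν := invRoot n with hνdef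
  have hν : 0 < ν := invRoot_pos hn0
  set E : ℕ → ℝ := fun k => ∫ ω, testFn p (sigmaOne p ^ 2 * A) x n k (S k ω) ∂μ with hE
  have hα := invRoot_pos (show 0 < A by linarith)
  have htel : E n - E 1 = ∑ i ∈ Finset.range N, (E (i + 1 + 1) - E (i + 1)) := by
    rw [Finset.sum_range_sub (fun i => E (i + 1))]
  change |E n - E 1| ≤ _
  have hterm : ∀ i ∈ Finset.range N, |E (i + 1 + 1) - E (i + 1)| ≤
      K * (ν ^ 4 * (1 / √((i : ℝ) + 1))
        + (C + 1) * ν ^ 2 * invRoot (A + (N - 1 - i : ℕ)) ^ 6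
        + ν ^ 4 * (1 / √((N - 1 - i : ℕ) + 1))
        + (1 + C * invRoot A ^ 2) * ν ^ 3 * invRoot ((N - 1 - i : ℕ) + 1) ^ 3) := by
    intro i hi
    have hi' := Finset.mem_range.1 hi
    have := h.testFn_step hp0 hp1 (x := x) hA1 hA hC (n := n) (k := i + 1) (by omega) (by omega)
      (hind (i + 1) (by omega) (by omega))
    rw [show n - 1 - (i + 1) = N - 1 - i by omega,
      show ((i + 1 : ℕ) : ℝ) = i + 1 by push_cast; rfl] at this
    exact this
  have hsN : ∀ m : ℕ, m ≤ n → √(m : ℝ) ≤ 1 / ν ^ 2 := by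
    intro m hm
    rw [hνdef, invRoot_sq, one_div_one_div]
    exact Real.sqrt_le_sqrt (by exact_mod_cast hm)
  have hrN : √√(N : ℝ) ≤ 1 / ν := by
    rw [hνdef, invRoot, one_div_one_div]
    exact Real.sqrt_le_sqrt (Real.sqrt_le_sqrt (by rw [hnN]; push_cast; linarith))
  have s1 := sum_one_div_sqrt_le N
  have s2 := sum_invRoot_pow_six_le hA1 N
  have s3 := sum_invRoot_cube_le N
  -- Late-time errors depend on the time still to go, so these sums are read backwards.
  have r1 := Finset.sum_range_reflect (fun j : ℕ => 1 / √((j : ℝ) + 1)) N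
  have r2 := Finset.sum_range_reflect (fun j : ℕ => invRoot (A + j) ^ 6) N
  have r3 := Finset.sum_range_reflect (fun j : ℕ => invRoot ((j : ℝ) + 1) ^ 3) N
  have hN2 := hsN N (by omega)
  rw [htel]
  calc |∑ i ∈ Finset.range N, (E (i + 1 + 1) - E (i + 1))|
      ≤ ∑ i ∈ Finset.range N, |E (i + 1 + 1) - E (i + 1)| := Finset.abs_sum_le_sum_abs _ _
    _ ≤ _ := Finset.sum_le_sum hterm
    _ = K * (ν ^ 4 * ∑ j ∈ Finset.range N, 1 / √((j : ℝ) + 1)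
        + (C + 1) * ν ^ 2 * ∑ j ∈ Finset.range N, invRoot (A + j) ^ 6
        + ν ^ 4 * ∑ j ∈ Finset.range N, 1 / √((j : ℝ) + 1)
        + (1 + C * invRoot A ^ 2) * ν ^ 3
          * ∑ j ∈ Finset.range N, invRoot ((j : ℝ) + 1) ^ 3) := by
        rw [← Finset.mul_sum, Finset.sum_add_distrib, Finset.sum_add_distrib,
          Finset.sum_add_distrib, ← Finset.mul_sum, ← Finset.mul_sum, ← Finset.mul_sum,
          ← Finset.mul_sum, r1, r2, r3]
    _ ≤ K * (ν ^ 4 * (2 * (1 / ν ^ 2)) + (C + 1) * ν ^ 2 * (6 * invRoot A ^ 2)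
        + ν ^ 4 * (2 * (1 / ν ^ 2)) + (1 + C * invRoot A ^ 2) * ν ^ 3 * (4 * (1 / ν))) := by
        gcongr
        · linarith
        · linarith
        · linarith
    _ = K * (8 + 6 * invRoot A ^ 2 + 10 * C * invRoot A ^ 2) * ν ^ 2 := by
        field_simp
        ring
    _ ≤ K * (14 + 10 * C * invRoot A ^ 2) * ν ^ 2 := by
        have : invRoot A ^ 2 ≤ 1 := by
          rw [invRoot_sq, div_le_one (Real.sqrt_pos.2 (by linarith))]
          exact Real.one_le_sqrt.2 hA1
        gcongr
        linarith
    _ = K * (14 + 10 * C / √A) / √n := by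
        rw [hνdef, invRoot_sq, invRoot_sq]
        ring

/-- The induction step: a Kolmogorov bound at all earlier times gives one at time `n`. -/
theorem abs_cdf_normLaw_sub_le [IsProbabilityMeasure μ] (h : IsSingletonChain μ p S)
    (hp0 : 0 < p) (hp1 : p < 1) {A C r : ℝ} (hA1 : 1 ≤ A) (hA : 4 ≤ sigmaOne p ^ 2 * A)
    (hC : 0 ≤ C) (hr : 0 ≤ r) (hr1 : 3 / 4 ≤ ncdf r) (hr2 : ncdf (-r) ≤ 1 / 4) {n : ℕ} (hn : 1 ≤ n)
    (hind : ∀ k, 1 ≤ k → k < n → ∀ t, |cdf (normLaw μ p S k) t - ncdf t| ≤ C / √k) (t : ℝ) :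
    |cdf (normLaw μ p S n) t - ncdf t|
      ≤ 2 * (100000 * scaleConst p ^ 8 * (14 + 10 * C / √A) + (scaleConst p + 204 * A)
        + (r + 64) * √A) / √n := by
  have hn' : (1 : ℝ) ≤ n := by exact_mod_cast hn
  have hσ := sigmaOne_pos hp0 hp1
  have hsn : 0 < √(n : ℝ) := Real.sqrt_pos.2 (by linarith)
  have hsA : 0 < √A := Real.sqrt_pos.2 (by linarith)
  have hprob := h.isProbabilityMeasure_normLaw hn
  have key := abs_cdf_sub_ncdf_le_of_smooth (normLaw μ p S n) (r := r) (α := √A / √n)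
    (Δ := (100000 * scaleConst p ^ 8 * (14 + 10 * C / √A)) / √n
      + (scaleConst p + 204 * A) / √n) hr hr1 hr2 (by positivity) ?_ t
  · refine key.trans_eq ?_
    ring
  intro x
  have h1 := h.abs_integral_testFn_sub_le hp0 hp1 hA1 hA hC hn hind (sigmaOne p * √n * x)
  have h2 := abs_testFn_one_sub_le hp0 hp1 hA1 hn x
  have e1 : ∫ ω, testFn p (sigmaOne p ^ 2 * A) (sigmaOne p * √n * x) n 1 (S 1 ω) ∂μ
      = testFn p (sigmaOne p ^ 2 * A) (sigmaOne p * √n * x) n 1 1 := by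
    simp [h.start]
  have e2 : ∫ ω, testFn p (sigmaOne p ^ 2 * A) (sigmaOne p * √n * x) n n (S n ω) ∂μ
      = ∫ y, ncdf ((x - y) / (√A / √n)) ∂(normLaw μ p S n) := by
    have hsq : √(remVar p (sigmaOne p ^ 2 * A) n n) = sigmaOne p * √A := by
      rw [remVar, decay_self, one_pow, mul_one, sub_self, mul_zero, add_zero,
        Real.sqrt_mul (by positivity), Real.sqrt_sq hσ.le]
    simp only [testFn, hsq]
    rw [h.integral_comp_eq_normLaw hp0 hp1 hn continuous_ncdf, decay_self]
    refine integral_congr_ae (Eventually.of_forall fun y => ?_)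
    simp only
    congr 1
    field_simp
  rw [e1, e2] at h1
  exact (abs_sub_le _ _ _).trans (add_le_add h1 h2)

end IsSingletonChain

/-- The Berry–Esseen bound for the chain `ν₁`. -/
theorem exists_berryEsseen_const {p : ℝ} (hp0 : 0 < p) (hp1 : p < 1) :
    ∃ C : ℝ, 0 < C ∧ ∀ (Ω : Type*) [MeasurableSpace Ω] (μ : Measure Ω) [IsProbabilityMeasure μ]
      (S : ℕ → Ω → ℕ), IsSingletonChain μ p S → ∀ n : ℕ, 1 ≤ n → ∀ t,
        |cdf (IsSingletonChain.normLaw μ p S n) t - ncdf t| ≤ C / √n := by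
  obtain ⟨r, hr, hr1, hr2⟩ := exists_ncdf_quartiles
  have hσ := sigmaOne_pos hp0 hp1
  have hL := two_le_scaleConst hp0 hp1
  have hLσ := one_div_sigmaOne_le hp0 hp1
  obtain ⟨K, hK⟩ : ∃ K, K = 100000 * scaleConst p ^ 8 := ⟨_, rfl⟩
  have hLK : scaleConst p ≤ K := by
    rw [hK]
    have : scaleConst p ^ 1 ≤ scaleConst p ^ 8 := pow_le_pow_right₀ (by linarith) (by norm_num)
    rw [pow_one] at this
    linarith
  have hK0 : 0 < K := by linarith
  -- The induction step returns C with factor 2 · 10 K / √A, which this choice makes 1/2. With B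
  -- collecting the terms free of C, the value C = 2B then reproduces itself: B + C/2 = 2B.
  obtain ⟨A, hAdef⟩ : ∃ A, A = (40 * K) ^ 2 := ⟨_, rfl⟩
  have hsA : √A = 40 * K := by rw [hAdef, Real.sqrt_sq (by positivity)]
  have hA1 : 1 ≤ A := by rw [hAdef]; nlinarith
  have hA : 4 ≤ sigmaOne p ^ 2 * A := by
    have h1 : 1 ≤ sigmaOne p * K := by
      rw [div_le_iff₀ hσ] at hLσ
      nlinarith
    rw [hAdef]
    nlinarith
  set B := 2 * (K * 14 + (scaleConst p + 204 * A) + (r + 64) * √A) with hB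
  have hB0 : 0 < B := by positivity
  refine ⟨2 * B, by positivity, fun Ω _ μ _ S h n => ?_⟩
  -- No separate base case: at n = 1 the telescoping sum is empty and the hypothesis on earlier
  -- times is vacuous.
  induction n using Nat.strong_induction_on with
  | _ n ih =>
    intro hn t
    have hsn : 0 < √(n : ℝ) := Real.sqrt_pos.2 (by exact_mod_cast hn)
    refine (h.abs_cdf_normLaw_sub_le hp0 hp1 hA1 hA (show 0 ≤ 2 * B by positivity) hr hr1 hr2 hn
      (fun k hk hkn => ih k hkn hk) t).trans ?_
    gcongr
    rw [← hK]
    have e : K * (10 * (2 * B) / √A) = B / 2 := by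
      rw [hsA]; field_simp; norm_num
    rw [mul_add, e]
    linarith

/-! ### One step of the algorithm on the set of times used once -/

section Combinatorics

variable {e u : ℕ → ℕ}

theorem label_one (e u : ℕ → ℕ) : label e u 1 = 1 := by
  rw [label, reinforced]; simp

theorem label_of_copy {l : ℕ} (hl : 2 ≤ l) (he : e l = 0) (hu1 : 1 ≤ u l) (hu2 : u l < l) :
    label e u l = label e u (u l) := by
  rw [label, reinforced, if_neg (by omega), dif_pos ⟨he, hu1, hu2⟩, label]

theorem label_of_new {l : ℕ} (hl : 2 ≤ l) (he : ¬(e l = 0 ∧ 1 ≤ u l ∧ u l < l)) :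
    label e u l = innovations e l := by
  rw [label, reinforced, if_neg (by omega), dif_neg he, id]

theorem innovations_succ (e : ℕ → ℕ) (n : ℕ) :
    innovations e (n + 1) = innovations e n + e (n + 1) := by
  rw [innovations, Finset.sum_Icc_succ_top (by omega), innovations]

theorem innovations_mono (e : ℕ → ℕ) : Monotone (innovations e) :=
  monotone_nat_of_le_succ fun n => by rw [innovations_succ]; omega

theorem label_mem (he : e 1 = 1) {l : ℕ} (hl : 1 ≤ l) :
    1 ≤ label e u l ∧ label e u l ≤ innovations e l := by
  have h1 : innovations e 1 = 1 := by simp [innovations, he]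
  induction l using Nat.strong_induction_on with
  | _ l ih =>
    have hi := innovations_mono e hl
    by_cases hl1 : l = 1
    · subst hl1
      rw [label_one]; omega
    by_cases hc : e l = 0 ∧ 1 ≤ u l ∧ u l < l
    · rw [label_of_copy (by omega) hc.1 hc.2.1 hc.2.2]
      have := ih (u l) hc.2.2 hc.2.1
      exact ⟨this.1, this.2.trans (innovations_mono e hc.2.2.le)⟩
    · rw [label_of_new (by omega) hc]
      omega

theorem innovations_congr {e e' : ℕ → ℕ} {n : ℕ} (he : ∀ j, 1 ≤ j → j ≤ n → e j = e' j) :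
    innovations e n = innovations e' n :=
  Finset.sum_congr rfl fun j hj => he j (Finset.mem_Icc.1 hj).1 (Finset.mem_Icc.1 hj).2

theorem label_congr {e e' u u' : ℕ → ℕ} {n : ℕ} (he : ∀ j, 1 ≤ j → j ≤ n → e j = e' j)
    (hu : ∀ j, 2 ≤ j → j ≤ n → u j = u' j) {l : ℕ} (hl1 : 1 ≤ l) (hln : l ≤ n) :
    label e u l = label e' u' l := by
  induction l using Nat.strong_induction_on with
  | _ l ih =>
    by_cases hl : l = 1
    · subst hl; rw [label_one, label_one]
    have h1 := he l (by omega) hln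
    have h2 := hu l (by omega) hln
    by_cases hc : e l = 0 ∧ 1 ≤ u l ∧ u l < l
    · rw [label_of_copy (by omega) hc.1 hc.2.1 hc.2.2, ih (u l) hc.2.2 hc.2.1 (by omega), h2,
        label_of_copy (e := e') (u := u') (l := l) (by omega) (by omega) (by omega) (by omega)]
    · rw [label_of_new (by omega) hc, label_of_new (by omega) (by rwa [← h1, ← h2])]
      exact innovations_congr fun j hj hjl => he j hj (by omega)

/-- The times up to `n` whose variable occurs exactly once up to time `n`. -/
def singleTimes (e u : ℕ → ℕ) (n : ℕ) : Finset ℕ :=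
  (Finset.Icc 1 n).filter fun l => occurrences e u (label e u l) n = 1

theorem singleTimes_congr {e e' u u' : ℕ → ℕ} {n : ℕ} (he : ∀ j, 1 ≤ j → j ≤ n → e j = e' j)
    (hu : ∀ j, 2 ≤ j → j ≤ n → u j = u' j) : singleTimes e u n = singleTimes e' u' n := by
  have hocc : ∀ j, occurrences e u j n = occurrences e' u' j n := fun j => by
    unfold occurrences
    congr 1
    refine Finset.filter_congr fun l hl => ?_
    rw [label_congr he hu (Finset.mem_Icc.1 hl).1 (Finset.mem_Icc.1 hl).2]
  refine Finset.filter_congr fun l hl => ?_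
  rw [hocc, label_congr he hu (Finset.mem_Icc.1 hl).1 (Finset.mem_Icc.1 hl).2]

theorem occurrences_pos {l n : ℕ} (hl : 1 ≤ l) (hln : l ≤ n) :
    1 ≤ occurrences e u (label e u l) n :=
  Finset.card_pos.2 ⟨l, Finset.mem_filter.2 ⟨Finset.mem_Icc.2 ⟨hl, hln⟩, rfl⟩⟩

theorem eq_of_occurrences_eq_one {j n l l' : ℕ} (h : occurrences e u j n = 1)
    (hl : l ∈ Finset.Icc 1 n) (hl' : l' ∈ Finset.Icc 1 n) (h1 : label e u l = j)
    (h2 : label e u l' = j) : l = l' :=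
  Finset.card_le_one.1 h.le l (Finset.mem_filter.2 ⟨hl, h1⟩) l' (Finset.mem_filter.2 ⟨hl', h2⟩)

/-- Variables occurring once correspond to the times at which they occur. Counting times rather than
labels makes the uniform choice of U directly visible. -/
theorem nu_one_eq_card (he : e 1 = 1) (n : ℕ) : nu e u 1 n = (singleTimes e u n).card := by
  symm
  refine Finset.card_bij (fun l _ => label e u l) ?_ ?_ ?_
  · intro l hl
    obtain ⟨h1, h2⟩ := Finset.mem_filter.1 hl
    obtain ⟨h3, h4⟩ := Finset.mem_Icc.1 h1
    have := label_mem (u := u) he h3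
    exact Finset.mem_filter.2 ⟨Finset.mem_Icc.2 ⟨this.1, this.2.trans (innovations_mono e h4)⟩, h2⟩
  · intro l hl l' hl' heq
    obtain ⟨h1, h2⟩ := Finset.mem_filter.1 hl
    exact eq_of_occurrences_eq_one h2 h1 (Finset.mem_filter.1 hl').1 rfl heq.symm
  · intro j hj
    have hj2 := (Finset.mem_filter.1 hj).2
    obtain ⟨l, hl⟩ := Finset.card_pos.1 (show 0 < occurrences e u j n by omega)
    obtain ⟨h1, h2⟩ := Finset.mem_filter.1 hl
    exact ⟨l, Finset.mem_filter.2 ⟨h1, by rw [h2]; exact hj2⟩, h2⟩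

theorem occurrences_succ (e u : ℕ → ℕ) (j n : ℕ) : occurrences e u j (n + 1)
    = occurrences e u j n + if label e u (n + 1) = j then 1 else 0 := by
  unfold occurrences
  rw [← Finset.insert_Icc_right_eq_Icc_add_one (by omega : 1 ≤ n + 1), Finset.filter_insert]
  split_ifs with h
  · rw [Finset.card_insert_of_notMem (by simp)]
  · rw [add_zero]

/-- All earlier labels are at most i(n), so the label i(n) + 1 is fresh and disturbs no other count.
-/
theorem singleTimes_succ_of_new (he1 : e 1 = 1) {n : ℕ} (hn : 1 ≤ n) (he : e (n + 1) = 1) :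
    singleTimes e u (n + 1) = insert (n + 1) (singleTimes e u n) := by
  have hlab : label e u (n + 1) = innovations e n + 1 := by
    rw [label_of_new (by omega) (by omega), innovations_succ, he]
  have hne : ∀ l, 1 ≤ l → l ≤ n → label e u (n + 1) ≠ label e u l := fun l h1 h2 => by
    have := (label_mem (u := u) he1 h1).2.trans (innovations_mono e h2)
    omega
  have hocc : occurrences e u (label e u (n + 1)) n = 0 := by
    refine Finset.card_eq_zero.2 (Finset.filter_eq_empty_iff.2 fun l hl => ?_)
    exact (hne l (Finset.mem_Icc.1 hl).1 (Finset.mem_Icc.1 hl).2).symm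
  ext l
  simp only [singleTimes, Finset.mem_filter, Finset.mem_Icc, Finset.mem_insert]
  by_cases hl : l = n + 1
  · subst hl
    simp [occurrences_succ, hocc]
  · by_cases hl2 : 1 ≤ l ∧ l ≤ n
    · rw [occurrences_succ, if_neg (hne l hl2.1 hl2.2)]
      constructor
      · rintro ⟨_, h⟩; exact Or.inr ⟨hl2, h⟩
      · rintro (h | h)
        · omega
        · exact ⟨by omega, h.2⟩
    · constructor
      · rintro ⟨h, _⟩; omega
      · rintro (h | h) <;> omega

/-- The copied variable now occurs at least twice, so neither its old time nor n + 1 is single. If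
it was already repeated, the erasure does nothing. -/
theorem singleTimes_succ_of_copy {n : ℕ} (hn : 1 ≤ n) (he : e (n + 1) = 0)
    (hu1 : 1 ≤ u (n + 1)) (hu2 : u (n + 1) ≤ n) :
    singleTimes e u (n + 1) = (singleTimes e u n).erase (u (n + 1)) := by
  have hlab : label e u (n + 1) = label e u (u (n + 1)) :=
    label_of_copy (by omega) he hu1 (by omega)
  ext l
  simp only [singleTimes, Finset.mem_filter, Finset.mem_Icc, Finset.mem_erase]
  by_cases hl : l = n + 1
  · subst hl
    have := occurrences_pos (e := e) (u := u) hu1 hu2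
    rw [occurrences_succ, if_pos rfl, hlab]
    constructor
    · rintro ⟨_, h⟩; omega
    · rintro ⟨_, h, _⟩; omega
  · by_cases hl2 : 1 ≤ l ∧ l ≤ n
    · have hpos := occurrences_pos (e := e) (u := u) hl2.1 hl2.2
      rw [occurrences_succ]
      by_cases hll : label e u (n + 1) = label e u l
      · rw [if_pos hll]
        constructor
        · rintro ⟨_, h⟩; omega
        · rintro ⟨h1, _, h2⟩
          exact absurd (eq_of_occurrences_eq_one h2 (Finset.mem_Icc.2 hl2)
            (Finset.mem_Icc.2 ⟨hu1, hu2⟩) rfl (by rw [← hll, hlab])) h1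
      · rw [if_neg hll, add_zero]
        constructor
        · rintro ⟨_, h⟩
          refine ⟨fun hlu => hll ?_, hl2, h⟩
          rw [hlab, hlu]
        · rintro ⟨_, _, h⟩; exact ⟨by omega, h⟩
    · constructor
      · rintro ⟨h, _⟩; omega
      · rintro ⟨_, h, _⟩; omega

theorem singleTimes_subset (e u : ℕ → ℕ) (n : ℕ) : singleTimes e u n ⊆ Finset.Icc 1 n :=
  Finset.filter_subset _ _

theorem singleTimes_one (e u : ℕ → ℕ) : singleTimes e u 1 = {1} := by
  ext l
  simp only [singleTimes, Finset.mem_filter, Finset.mem_Icc, Finset.mem_singleton]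
  constructor
  · rintro ⟨h, _⟩; omega
  · rintro rfl
    refine ⟨by omega, ?_⟩
    simp [occurrences, Finset.filter_singleton]

theorem sum_erase_card {n : ℕ} {A : Finset ℕ} (hA : A ⊆ Finset.Icc 1 n) (f : ℝ → ℝ) :
    ∑ l ∈ Finset.Icc 1 n, f ((A.erase l).card : ℝ)
      = A.card * f (A.card - 1) + (n - A.card) * f A.card := by
  have e : ∀ l ∈ Finset.Icc 1 n, f ((A.erase l).card : ℝ)
      = if l ∈ A then f (A.card - 1) else f A.card := by
    intro l _
    split_ifs with h
    · rw [Finset.card_erase_of_mem h, Nat.cast_sub (Finset.card_pos.2 ⟨l, h⟩), Nat.cast_one]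
    · rw [Finset.erase_eq_of_notMem h]
  rw [Finset.sum_congr rfl e, Finset.sum_ite, Finset.sum_const, Finset.sum_const, nsmul_eq_mul,
    nsmul_eq_mul, Finset.filter_mem_eq_inter, Finset.inter_eq_right.2 hA,
    Finset.filter_notMem_eq_sdiff, Finset.card_sdiff_of_subset hA, Nat.card_Icc,
    Nat.cast_sub (by simpa using Finset.card_le_card hA)]
  simp

end Combinatorics

/-! ### From the random inputs to the chain -/

theorem ae_mem_of_sum_eq_one {Ω : Type*} [MeasurableSpace Ω] {μ : Measure Ω}
    [IsProbabilityMeasure μ] {X : Ω → ℕ} (hX : Measurable X) {F : Finset ℕ}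
    (hF : ∑ k ∈ F, μ.real {ω | X ω = k} = 1) : ∀ᵐ ω ∂μ, X ω ∈ F := by
  have hm : ∀ k, MeasurableSet {ω | X ω = k} := fun k => hX (measurableSet_singleton k)
  have h1 : μ.real (⋃ k ∈ F, {ω | X ω = k}) = 1 := by
    rw [← hF, measureReal_biUnion_finset]
    · intro i _ j _ hij
      refine Set.disjoint_left.2 fun ω h1 h2 => hij ?_
      exact (Set.mem_ofPred.1 h1).symm.trans h2
    · exact fun k _ => hm k
  have h2 : μ (⋃ k ∈ F, {ω | X ω = k}) = 1 := by
    rw [Measure.real] at h1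
    exact (ENNReal.toReal_eq_one_iff _).1 h1
  have h3 := (prob_compl_eq_zero_iff (F.measurableSet_biUnion fun k _ => hm k)).2 h2
  filter_upwards [compl_mem_ae_iff.2 h3] with ω hω
  simpa using hω

namespace IsInput

variable {Ω : Type*} [MeasurableSpace Ω] {μ : Measure Ω} {p : ℝ} {ε U : ℕ → Ω → ℕ}

/-- The inputs `ε₂, ε₃, …, U₂, U₃, …` as one family. -/
abbrev family (ε U : ℕ → Ω → ℕ) : ℕ ⊕ ℕ → Ω → ℕ :=
  Sum.elim (fun k : ℕ => ε (k + 2)) (fun k : ℕ => U (k + 2))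

theorem measurable_family (h : IsInput μ p ε U) (i : ℕ ⊕ ℕ) : Measurable (family ε U i) := by
  rcases i with k | k
  · exact h.measurable_eps _ (by omega)
  · exact h.measurable_U _ (by omega)

/-- The indices of the inputs used up to time `n`. -/
def past (n : ℕ) : Finset (ℕ ⊕ ℕ) := (Finset.range (n - 1)).disjSum (Finset.range (n - 1))

/-- The indices of the inputs used at time `n + 1`. -/
def present (n : ℕ) : Finset (ℕ ⊕ ℕ) := {Sum.inl (n - 1), Sum.inr (n - 1)}

theorem disjoint_past_present (n : ℕ) : Disjoint (past n) (present n) := by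
  rw [Finset.disjoint_left]
  intro i hi hi'
  simp only [present, Finset.mem_insert, Finset.mem_singleton] at hi'
  rcases hi' with rfl | rfl <;> simp [past] at hi

theorem inl_mem_past {n j : ℕ} (h2 : 2 ≤ j) (hj : j ≤ n) : Sum.inl (j - 2) ∈ past n := by
  simp [past]; omega

theorem inr_mem_past {n j : ℕ} (h2 : 2 ≤ j) (hj : j ≤ n) : Sum.inr (j - 2) ∈ past n := by
  simp [past]; omega

/-- The set of single times, as a function of the past inputs. -/
noncomputable def singleTimesOfPast (n : ℕ) (w : past n → ℕ) : Finset ℕ :=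
  singleTimes
    (fun j => if h : 2 ≤ j ∧ j ≤ n then w ⟨Sum.inl (j - 2), inl_mem_past h.1 h.2⟩ else 1)
    (fun j => if h : 2 ≤ j ∧ j ≤ n then w ⟨Sum.inr (j - 2), inr_mem_past h.1 h.2⟩ else 1) n

theorem singleTimes_eq (h : IsInput μ p ε U) (n : ℕ) (ω : Ω) :
    singleTimes (fun j => ε j ω) (fun j => U j ω) n
      = singleTimesOfPast n fun i => family ε U i ω := by
  refine singleTimes_congr (fun j hj hjn => ?_) fun j hj hjn => ?_
  · by_cases h2 : 2 ≤ j
    · rw [dif_pos ⟨h2, hjn⟩]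
      simp [family, Nat.sub_add_cancel h2]
    -- The default value 1 in `singleTimesOfPast` is ε₁; U₁ is never consulted.
    · obtain rfl : j = 1 := by omega
      rw [dif_neg (by omega), h.eps_one]
  · rw [dif_pos ⟨hj, hjn⟩]
    simp [family, Nat.sub_add_cancel hj]

theorem measurable_comp_singleTimes (h : IsInput μ p ε U) (n : ℕ) {β : Type*} [MeasurableSpace β]
    (g : Finset ℕ → β) :
    Measurable fun ω => g (singleTimes (fun j => ε j ω) (fun j => U j ω) n) := by
  simp_rw [h.singleTimes_eq n]
  exact (Measurable.of_discrete (f := fun w : past n → ℕ => g (singleTimesOfPast n w))).comp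
    (measurable_pi_lambda _ fun i => h.measurable_family i)

theorem integrable_comp_singleTimes [IsProbabilityMeasure μ] (h : IsInput μ p ε U) (n : ℕ)
    (g : Finset ℕ → ℝ) :
    Integrable (fun ω => g (singleTimes (fun j => ε j ω) (fun j => U j ω) n)) μ := by
  refine Integrable.of_bound (h.measurable_comp_singleTimes n g).aestronglyMeasurable
    (∑ A ∈ (Finset.Icc 1 n).powerset, |g A|) (Eventually.of_forall fun ω => ?_)
  exact Finset.single_le_sum (f := fun A => |g A|) (fun A _ => abs_nonneg _)
    (Finset.mem_powerset.2 (singleTimes_subset _ _ n))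

/-- The inputs at time `n + 1` are independent of the configuration at time `n`. -/
theorem integral_indicator_mul [IsProbabilityMeasure μ] (h : IsInput μ p ε U) {n : ℕ} (hn : 1 ≤ n)
    (g : Finset ℕ → ℝ) (b : ℕ → ℕ → ℝ)
    (hb : Integrable (fun ω => b (ε (n + 1) ω) (U (n + 1) ω)) μ) :
    ∫ ω, b (ε (n + 1) ω) (U (n + 1) ω)
        * g (singleTimes (fun j => ε j ω) (fun j => U j ω) n) ∂μ
      = (∫ ω, b (ε (n + 1) ω) (U (n + 1) ω) ∂μ)
        * ∫ ω, g (singleTimes (fun j => ε j ω) (fun j => U j ω) n) ∂μ := by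
  have hind := (iIndepFun.indepFun_finset (past n) (present n) (disjoint_past_present n) h.indep
    h.measurable_family).symm
  have hl : Sum.inl (n - 1) ∈ present n := by simp [present]
  have hr : Sum.inr (n - 1) ∈ present n := by simp [present]
  have hc := hind.comp
    (Measurable.of_discrete (f := fun w : present n → ℕ => b (w ⟨_, hl⟩) (w ⟨_, hr⟩)))
    (Measurable.of_discrete (f := fun w : past n → ℕ => g (singleTimesOfPast n w)))
  -- The family starts at time 2, so index n - 1 carries the inputs of time n + 1, while the past
  -- uses indices below n - 1.
  have e : n - 1 + 2 = n + 1 := by omega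
  have e1 : ((fun w : present n → ℕ => b (w ⟨_, hl⟩) (w ⟨_, hr⟩)) ∘
      fun ω (i : present n) => family ε U i ω) = fun ω => b (ε (n + 1) ω) (U (n + 1) ω) := by
    funext ω
    simp [family, e]
  have e2 : ((fun w : past n → ℕ => g (singleTimesOfPast n w)) ∘
      fun ω (i : past n) => family ε U i ω)
      = fun ω => g (singleTimes (fun j => ε j ω) (fun j => U j ω) n) := by
    funext ω
    rw [h.singleTimes_eq n ω, Function.comp_def]
  have hc' : IndepFun (fun ω => b (ε (n + 1) ω) (U (n + 1) ω))
      (fun ω => g (singleTimes (fun j => ε j ω) (fun j => U j ω) n)) μ := by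
    rw [← e1, ← e2]; exact hc
  exact hc'.integral_fun_mul_eq_mul_integral hb.aestronglyMeasurable
    (h.integrable_comp_singleTimes n g).aestronglyMeasurable

theorem prob_copy [IsProbabilityMeasure μ] (h : IsInput μ p ε U) {n l : ℕ} (hn : 1 ≤ n)
    (hl : l ∈ Finset.Icc 1 n) :
    μ.real {ω | ε (n + 1) ω = 0 ∧ U (n + 1) ω = l} = (1 - p) / n := by
  obtain ⟨h1, h2⟩ := Finset.mem_Icc.1 hl
  have hind : IndepFun (ε (n + 1)) (U (n + 1)) μ := by
    have := h.indep.indepFun (show Sum.inl (n - 1) ≠ Sum.inr (n - 1) by simp)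
    simpa only [Sum.elim_inl, Sum.elim_inr, show n - 1 + 2 = n + 1 by omega] using this
  have := hind.measure_inter_preimage_eq_mul {0} {l} (measurableSet_singleton _)
    (measurableSet_singleton _)
  have e0 := h.prob_eps_zero (n + 1) (by omega)
  have e1 := h.prob_U (n + 1) (by omega) l h1 (by omega)
  push_cast at e1
  rw [add_sub_cancel_right] at e1
  calc μ.real {ω | ε (n + 1) ω = 0 ∧ U (n + 1) ω = l}
      = μ.real {ω | ε (n + 1) ω = 0} * μ.real {ω | U (n + 1) ω = l} := by
        rw [Measure.real, Measure.real, Measure.real, ← ENNReal.toReal_mul]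
        exact congrArg ENNReal.toReal this
    _ = (1 - p) / n := by rw [e0, e1]; ring

/-- The pair (ε, U) at time n + 1 is independent of the configuration at time n. Each copied time l
≤ n has probability (1-p)/n, and averaging the erasure over l leaves only the cardinality
(`sum_erase_card`). -/
theorem isSingletonChain [IsProbabilityMeasure μ] (h : IsInput μ p ε U) :
    IsSingletonChain μ p fun n ω => nu (fun j => ε j ω) (fun j => U j ω) 1 n := by
  have hcard : ∀ n ω, nu (fun j => ε j ω) (fun j => U j ω) 1 n
      = (singleTimes (fun j => ε j ω) (fun j => U j ω) n).card := fun n ω =>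
    nu_one_eq_card (h.eps_one ω) n
  simp only [hcard]
  refine ⟨fun n _ => h.measurable_comp_singleTimes n Finset.card, fun n _ ω => ?_, fun ω => ?_,
    fun n hn f => ?_⟩
  · simpa using Finset.card_le_card (singleTimes_subset (fun j => ε j ω) (fun j => U j ω) n)
  · rw [singleTimes_one, Finset.card_singleton]
  set A : Ω → Finset ℕ := fun ω => singleTimes (fun j => ε j ω) (fun j => U j ω) n with hA
  have hmε := h.measurable_eps (n + 1) (by omega)
  have hmU := h.measurable_U (n + 1) (by omega)
  have hn0 : (0 : ℝ) < n := by exact_mod_cast hn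
  have aeε : ∀ᵐ ω ∂μ, ε (n + 1) ω ∈ ({0, 1} : Finset ℕ) := by
    refine ae_mem_of_sum_eq_one hmε ?_
    rw [Finset.sum_pair (by norm_num), h.prob_eps_zero (n + 1) (by omega),
      h.prob_eps_one (n + 1) (by omega)]
    ring
  have aeU : ∀ᵐ ω ∂μ, U (n + 1) ω ∈ Finset.Icc 1 n := by
    refine ae_mem_of_sum_eq_one hmU ?_
    rw [Finset.sum_congr rfl fun k hk => h.prob_U (n + 1) (by omega) k (Finset.mem_Icc.1 hk).1
      (Nat.lt_succ_of_le (Finset.mem_Icc.1 hk).2), Finset.sum_const, Nat.card_Icc, nsmul_eq_mul]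
    push_cast
    rw [add_sub_cancel_right]
    field_simp
  let new : ℕ → ℕ → ℝ := fun a _ => if a = 1 then 1 else 0
  let copy : ℕ → ℕ → ℕ → ℝ := fun l a b => if a = 0 ∧ b = l then 1 else 0
  -- Almost surely exactly one of the indicators `new` and `copy l` is 1, so every term is a
  -- function of the new inputs times a function of the past.
  have hpt : ∀ᵐ ω ∂μ, f ((singleTimes (fun j => ε j ω) (fun j => U j ω) (n + 1)).card : ℝ)
      = new (ε (n + 1) ω) (U (n + 1) ω) * f ((A ω).card + 1)
        + ∑ l ∈ Finset.Icc 1 n, copy l (ε (n + 1) ω) (U (n + 1) ω) * f (((A ω).erase l).card) := by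
    filter_upwards [aeε, aeU] with ω h1 h2
    obtain ⟨hu1, hu2⟩ := Finset.mem_Icc.1 h2
    simp only [Finset.mem_insert, Finset.mem_singleton] at h1
    rcases h1 with h1 | h1
    · rw [singleTimes_succ_of_copy (e := fun j => ε j ω) (u := fun j => U j ω) hn h1 hu1 hu2]
      simp only [new, copy, h1, zero_ne_one, if_false, zero_mul, zero_add, true_and, ite_mul,
        one_mul]
      rw [Finset.sum_ite_eq, if_pos h2]
    · rw [singleTimes_succ_of_new (e := fun j => ε j ω) (u := fun j => U j ω) (h.eps_one ω) hn h1,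
        Finset.card_insert_of_notMem fun hmem => by
          have := Finset.mem_Icc.1 (singleTimes_subset _ _ n hmem)
          omega]
      simp [new, copy, h1, hA]
  have mnew : MeasurableSet {ω | ε (n + 1) ω = 1} := hmε (measurableSet_singleton 1)
  have mcopy : ∀ l, MeasurableSet {ω | ε (n + 1) ω = 0 ∧ U (n + 1) ω = l} := fun l =>
    (hmε (measurableSet_singleton 0)).inter (hmU (measurableSet_singleton l))
  have enew : (fun ω => new (ε (n + 1) ω) (U (n + 1) ω))
      = {ω | ε (n + 1) ω = 1}.indicator 1 := by
    funext ω; simp [new, Set.indicator]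
  have ecopy : ∀ l, (fun ω => copy l (ε (n + 1) ω) (U (n + 1) ω))
      = {ω | ε (n + 1) ω = 0 ∧ U (n + 1) ω = l}.indicator 1 := by
    intro l; funext ω; simp [copy, Set.indicator]
  have inew : Integrable (fun ω => new (ε (n + 1) ω) (U (n + 1) ω)) μ := by
    rw [enew]; exact (integrable_const (1 : ℝ)).indicator mnew
  have icopy : ∀ l, Integrable (fun ω => copy l (ε (n + 1) ω) (U (n + 1) ω)) μ := by
    intro l; rw [ecopy]; exact (integrable_const (1 : ℝ)).indicator (mcopy l)
  have bmul : ∀ (b : Ω → ℝ) (g : Finset ℕ → ℝ), Integrable b μ →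
      Integrable (fun ω => b ω * g (A ω)) μ := by
    intro b g hb
    refine hb.mul_bdd (c := ∑ A ∈ (Finset.Icc 1 n).powerset, |g A|)
      (h.measurable_comp_singleTimes n g).aestronglyMeasurable (Eventually.of_forall fun ω => ?_)
    exact Finset.single_le_sum (f := fun A => |g A|) (fun A _ => abs_nonneg _)
      (Finset.mem_powerset.2 (singleTimes_subset _ _ n))
  have vnew : ∫ ω, new (ε (n + 1) ω) (U (n + 1) ω) ∂μ = p := by
    rw [enew, integral_indicator_one mnew, h.prob_eps_one (n + 1) (by omega)]
  have vcopy : ∀ l ∈ Finset.Icc 1 n,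
      ∫ ω, copy l (ε (n + 1) ω) (U (n + 1) ω) ∂μ = (1 - p) / n := by
    intro l hl
    rw [ecopy, integral_indicator_one (mcopy l), h.prob_copy hn hl]
  rw [integral_congr_ae hpt, integral_add (bmul _ (fun A => f (A.card + 1)) inew)
    (integrable_finsetSum _ fun l _ => bmul _ (fun A => f ((A.erase l).card)) (icopy l)),
    integral_finsetSum _ fun l _ => bmul _ (fun A => f ((A.erase l).card)) (icopy l),
    h.integral_indicator_mul hn (fun A => f (A.card + 1)) new inew, vnew,
    Finset.sum_congr rfl fun l hl => by
      rw [h.integral_indicator_mul hn (fun A => f ((A.erase l).card)) (copy l) (icopy l),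
        vcopy l hl],
    ← Finset.mul_sum,
    ← integral_finsetSum _ fun l _ =>
      h.integrable_comp_singleTimes n fun A => f ((A.erase l).card),
    ← integral_const_mul, ← integral_const_mul,
    ← integral_add ((h.integrable_comp_singleTimes n fun A => f (A.card + 1)).const_mul p)
      ((integrable_finsetSum _ fun l _ =>
        h.integrable_comp_singleTimes n fun A => f ((A.erase l).card)).const_mul _)]
  refine integral_congr_ae (Eventually.of_forall fun ω => ?_)
  simp only
  rw [sum_erase_card (singleTimes_subset _ _ n)]
  field_simp
  ring

end IsInput

end StepReinforced

theorem mainTheorem5 (p : ℝ) (hp0 : 0 < p) (hp1 : p < 1) :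
    ∃ C : ℝ, 0 < C ∧
      ∀ (Ω : Type*) [MeasurableSpace Ω] (μ : Measure Ω) [IsProbabilityMeasure μ]
        (ε U : ℕ → Ω → ℕ), StepReinforced.IsInput μ p ε U →
        ∀ n : ℕ, 1 ≤ n →
          StepReinforced.dK μ (fun ω =>
            ((StepReinforced.nu (fun j => ε j ω) (fun j => U j ω) 1 n : ℝ)
                - (n : ℝ) * p / (2 - p))
              / (StepReinforced.sigmaOne p * √(n : ℝ)))
            ≤ C * (n : ℝ) ^ (-(1 / 2) : ℝ) := by
  obtain ⟨C, hC, hbound⟩ := StepReinforced.exists_berryEsseen_const hp0 hp1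
  refine ⟨C, hC, fun Ω _ μ _ ε U h n hn => ?_⟩
  have hchain := h.isSingletonChain
  have hprob := hchain.isProbabilityMeasure_normLaw hn
  refine ciSup_le fun x => ?_
  have hb := hbound Ω μ _ hchain n hn x
  rw [Real.rpow_neg (by positivity), ← Real.sqrt_eq_rpow, ← div_eq_mul_inv]
  rw [cdf_eq_real, StepReinforced.IsSingletonChain.normLaw,
    map_measureReal_apply (hchain.measurable_norm hn) measurableSet_Iic] at hb
  simp only [mul_div_assoc]
  exact hb
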